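/- Let $C_{\mathbb Z}$ be one of the following split composition rings: the binarions $\mathbb B_{\mathbb Z}$ (diagonal integral $2\times2$ matrices), the quaternions $\mathbb H_{\mathbb Z}=M_2(\mathbb Z)$, or the octonions $\mathbb O_{\mathbb Z}=\mathbb H_{\mathbb Z}\oplus\mathbb H_{\mathbb Z}v$ with $(a+bv)(c+dv)=(ac-\bar d\,b)+(da+b\,\bar c)v$, where $a\mapsto\bar a$ is the symplectic involution on $M_2(\mathbb Z)$ and $\overline{a+bv}=\bar a-bv$. Write $n$ and $\operatorname{t}$ for the norm and trace of $C_{\mathbb Z}$. Let $\mathfrak J_{\mathbb Z}$ be either $\mathbb Z\oplus\mathbb Z\oplus\mathbb Z$ (viewed as the diagonal $3\times 3$ matrices) or the module $\mathcal H_3(C_{\mathbb Z})$ of Hermitian $3\times3$ matrices $$A=\begin{pmatrix}a&z&\bar y\\ \bar z&b&x\\ y&\bar x&c\end{pmatrix},\qquad a,b,c\in\mathbb Z,\ x,y,z\in C_{\mathbb Z},$$ with cubic form $N(A)=abc-a\,n(x)-b\,n(y)-c\,n(z)+\operatorname{t}((xy)z)$, trace bilinear form $(A,B)=\operatorname{tr}\bigl(\tfrac12(AB+BA)\bigr)$,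 and adjoint $A^\#$, the quadratic map with $(A^\#,B)=3N(A,A,B)$, where $N(\cdot,\cdot,\cdot)$ is the symmetric trilinear form with $N(A,A,A)=N(A)$ (for $\mathbb Z\oplus\mathbb Z\oplus\mathbb Z$ omit the off-diagonal entries). Let $\mathfrak M_{\mathbb Z}=\mathbb Z\oplus\mathbb Z\oplus\mathfrak J_{\mathbb Z}\oplus\mathfrak J_{\mathbb Z}$, with elements $x=(\alpha,\beta,A,B)$ and its natural coordinates (of rank $8,20,32,56$ respectively). It carries the forms $$\{(\alpha,\beta,A,B),(\gamma,\delta,C,D)\}=\alpha\delta-\beta\gamma+(A,D)-(B,C),$$ $$q'(x)=-4(A^\#,B^\#)+4\alpha N(A)+4\beta N(B)+\bigl((A,B)-\alpha\beta\bigr)^2,\qquad q=-2q'.$$ Let $q(\cdot,\cdot,\cdot,\cdot)$ be the symmetric four-linear form on $\mathfrak M_{\mathbb Z}\otimes\mathbb Q$ with $q(x,x,x,x)=q(x)$, and let $T$ be the trilinear operator on $\mathfrak M_{\mathbb Z}\otimes\mathbb Q$ given by $\{T(x,y,z),w\}=q(x,y,z,w)$ for all $w$. Let $G_{\mathbb Z}$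 be the group of invertible $\mathbb Z$-linear transformations of $\mathfrak M_{\mathbb Z}$ preserving $q$ and $\{\cdot,\cdot\}$. For $\mathfrak J_{\mathbb Z}=\mathbb Z\oplus\mathbb Z\oplus\mathbb Z$ an element $(\alpha,\beta,(a_1,a_2,a_3),(b_1,b_2,b_3))$ is called projective if for each cyclic permutation $(i,j,k)$ of $(1,2,3)$ the binary quadratic form with coefficients $$\alpha a_i-b_jb_k,\qquad -a_ib_i+a_jb_j+a_kb_k-\alpha\beta,\qquad \beta b_i-a_ja_k$$ is primitive, that is, the gcd of its coefficients is $1$. For $\mathfrak J_{\mathbb Z}=\mathcal H_3(C_{\mathbb Z})$ an element of $\mathfrak M_{\mathbb Z}$ is called projective if its $G_{\mathbb Z}$-orbit contains an element $(\alpha,\beta,\operatorname{diag}(a_1,a_2,a_3),0)$ with $\alpha>0$, $\alpha\mid\beta$ and $\alpha\mid a_i$ for all $i$, such that $(\alpha,\beta,(a_1,a_2,a_3),(0,0,0))$ is projective in the previous sense. Then the operator $T$ is well defined, all partial derivatives of the polynomial $q'$ in the natural coordinates have even coefficients, and for every $x\in\mathfrak M_{\mathbb Z}$ one has $T(x,x,x)\in\mathfrak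 M_{\mathbb Z}$ and $$\gcd T(x,x,x)=\gcd\tfrac12\nabla q'(x),$$ where $\gcd$ denotes the nonnegative greatest common divisor of the coordinates. Consequently: * if $\gcd\tfrac12\nabla q'(x)=1$, then $x$ is projective; * if $\gcd\tfrac12\nabla q'(x)\ge3$ or $\nabla q'(x)=0$, then $x$ is not projective. -/

import Mathlib

namespace Freudenthal

/-! ### Split composition algebras -/

/-- Labels for the coefficient algebra `C` of the Jordan algebra `H_3(C)` of Hermitian
`3 × 3` matrices: `C = 0`, split binarions, split quaternions, split octonions.
The label `zero` gives the diagonal matrices, that is `H_3(0) = R ⊕ R ⊕ R`. -/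
inductive Coeff : Type
  | zero
  | bin
  | quat
  | oct

/-- The rank of the coefficient algebra. -/
def Coeff.dim : Coeff → ℕ
  | .zero => 0
  | .bin => 2
  | .quat => 4
  | .oct => 8

section Composition

variable {R : Type*} [CommRing R]

/-- Product of `2 × 2` matrices; `![a, b, c, d]` is the matrix with rows `(a, b)`, `(c, d)`. -/
def quatMul (a b : Fin 4 → R) : Fin 4 → R :=
  ![a 0 * b 0 + a 1 * b 2, a 0 * b 1 + a 1 * b 3,
    a 2 * b 0 + a 3 * b 2, a 2 * b 1 + a 3 * b 3]

/-- The symplectic involution of `2 × 2` matrices. -/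
def quatConj (a : Fin 4 → R) : Fin 4 → R := ![a 3, -a 1, -a 2, a 0]

/-- The determinant of `2 × 2` matrices. -/
def quatNorm (a : Fin 4 → R) : R := a 0 * a 3 - a 1 * a 2

/-- An octonion `a + b v` is stored as the coordinates of `a` followed by those of `b`:
this is its part `a`. -/
def octFst (u : Fin 8 → R) : Fin 4 → R := ![u 0, u 1, u 2, u 3]

/-- The part `b` of an octonion `a + b v`. -/
def octSnd (u : Fin 8 → R) : Fin 4 → R := ![u 4, u 5, u 6, u 7]

/-- The octonion `a + b v`. -/
def octMk (a b : Fin 4 → R) : Fin 8 → R := ![a 0, a 1, a 2, a 3, b 0, b 1, b 2, b 3]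

/-- The coefficient algebra over `R`, in its natural coordinates. Binarions are the diagonal
`2 × 2` matrices, quaternions all `2 × 2` matrices, octonions pairs of quaternions. -/
abbrev Comp (c : Coeff) (R : Type*) : Type _ := Fin c.dim → R

/-- Multiplication; for octonions
`(a + b v) (c + d v) = (a c - conj d * b) + (d a + b * conj c) v`. -/
def compMul : (c : Coeff) → Comp c R → Comp c R → Comp c R
  | .zero, _, _ => (0 : Fin 0 → R)
  | .bin, a, b => (fun i : Fin 2 => a i * b i)
  | .quat, a, b => quatMul a b
  | .oct, u, w =>
      octMk (quatMul (octFst u) (octFst w) - quatMul (quatConj (octSnd w)) (octSnd u))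
        (quatMul (octSnd w) (octFst u) + quatMul (octSnd u) (quatConj (octFst w)))

/-- Conjugation. -/
def compConj : (c : Coeff) → Comp c R → Comp c R
  | .zero, _ => (0 : Fin 0 → R)
  | .bin, (a : Fin 2 → R) => (![a 1, a 0] : Fin 2 → R)
  | .quat, a => quatConj a
  | .oct, u => octMk (quatConj (octFst u)) (-octSnd u)

/-- The multiplicative quadratic form. -/
def compNorm : (c : Coeff) → Comp c R → R
  | .zero, _ => 0
  | .bin, (a : Fin 2 → R) => a 0 * a 1
  | .quat, a => quatNorm a
  | .oct, u => quatNorm (octFst u) + quatNorm (octSnd u)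

/-- The trace. -/
def compTrace : (c : Coeff) → Comp c R → R
  | .zero, _ => 0
  | .bin, (a : Fin 2 → R) => a 0 + a 1
  | .quat, (a : Fin 4 → R) => a 0 + a 3
  | .oct, (u : Fin 8 → R) => u 0 + u 3

end Composition

/-! ### The cubic Jordan algebra of Hermitian matrices -/

/-- Coordinates of a Hermitian matrix: `inl i` are the diagonal entries, `inr (i, j)` are the
coordinates of the off-diagonal entry opposite to the `i`-th diagonal entry. -/
abbrev HermIdx (c : Coeff) : Type := Fin 3 ⊕ (Fin 3 × Fin c.dim)

/-- The Hermitian matrices over the coefficient algebra. With diagonal entries `a, b, d` and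
`x, y, z` the off-diagonal entries number `0, 1, 2`, the matrix is
`(a, z, conj y; conj z, b, x; y, conj x, d)`. -/
abbrev Herm (c : Coeff) (R : Type*) : Type _ := HermIdx c → R

section Jordan

variable {c : Coeff} {R : Type*} [CommRing R]

/-- The `i`-th diagonal entry. -/
def Herm.d (A : Herm c R) (i : Fin 3) : R := A (Sum.inl i)

/-- The `i`-th off-diagonal entry. -/
def Herm.o (A : Herm c R) (i : Fin 3) : Comp c R := fun j => A (Sum.inr (i, j))

/-- The diagonal matrix with given entries. -/
def Herm.diag (c : Coeff) (a : Fin 3 → R) : Herm c R := Sum.elim a (fun _ => 0)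

/-- The cubic form `a b d - a n(x) - b n(y) - d n(z) + tr ((x y) z)`. -/
def Herm.norm (A : Herm c R) : R :=
  A.d 0 * A.d 1 * A.d 2 - ∑ i, A.d i * compNorm c (A.o i)
    + compTrace c (compMul c (compMul c (A.o 0) (A.o 1)) (A.o 2))

/-- The adjoint matrix. The indices `i + 1`, `i + 2` are taken modulo `3`. -/
def Herm.sharp (A : Herm c R) : Herm c R :=
  Sum.elim
    (fun i => A.d (i + 1) * A.d (i + 2) - compNorm c (A.o i))
    (fun p => compConj c (compMul c (A.o (p.1 + 1)) (A.o (p.1 + 2))) p.2 - A.d p.1 * A.o p.1 p.2)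

/-- The trace bilinear form `(A, B) = tr (1/2 (A B + B A))`. -/
def Herm.tr (A B : Herm c R) : R :=
  ∑ i, A.d i * B.d i + ∑ i, compTrace c (compMul c (A.o i) (compConj c (B.o i)))

end Jordan

/-! ### The Freudenthal module -/

/-- Coordinates on the Freudenthal module: `α`, `β`, the coordinates of `A`, those of `B`. -/
abbrev FIdx (c : Coeff) : Type := Fin 2 ⊕ (HermIdx c ⊕ HermIdx c)

/-- The Freudenthal module `M(J) = R ⊕ R ⊕ J ⊕ J` of `J = H_3(C)`, in its natural coordinates. -/
abbrev FMod (c : Coeff) (R : Type*) : Type _ := FIdx c → R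

section Module

variable {c : Coeff} {R : Type*} [CommRing R]

/-- The component `α` of `(α, β, A, B)`. -/
def FMod.α (x : FMod c R) : R := x (Sum.inl 0)

/-- The component `β` of `(α, β, A, B)`. -/
def FMod.β (x : FMod c R) : R := x (Sum.inl 1)

/-- The component `A` of `(α, β, A, B)`. -/
def FMod.A (x : FMod c R) : Herm c R := fun i => x (Sum.inr (Sum.inl i))

/-- The component `B` of `(α, β, A, B)`. -/
def FMod.B (x : FMod c R) : Herm c R := fun i => x (Sum.inr (Sum.inr i))

/-- The element `(α, β, A, B)`. -/
def FMod.mk (α β : R) (A B : Herm c R) : FMod c R := Sum.elim ![α, β] (Sum.elim A B)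

/-- The skew-symmetric bilinear form. -/
def symp (x y : FMod c R) : R :=
  x.α * y.β - x.β * y.α + Herm.tr x.A y.B - Herm.tr x.B y.A

/-- The modified quartic form `q'`. -/
def quartic' (x : FMod c R) : R :=
  -4 * Herm.tr x.A.sharp x.B.sharp + 4 * x.α * x.A.norm + 4 * x.β * x.B.norm
    + (Herm.tr x.A x.B - x.α * x.β) ^ 2

/-- The quartic form `q = -2 q'`. -/
def quartic (x : FMod c R) : R := -2 * quartic' x

end Module

/-! ### The triple product -/

section Triple

variable {c : Coeff}

/-- The full linearization of `q`: the symmetric four-linear form with `q(x,x,x,x) = q(x)`. -/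
def quarticLin (x y z w : FMod c ℚ) : ℚ :=
  (1 / 24) *
    (quartic (x + y + z + w)
      - quartic (x + y + z) - quartic (x + y + w) - quartic (x + z + w) - quartic (y + z + w)
      + quartic (x + y) + quartic (x + z) + quartic (x + w)
      + quartic (y + z) + quartic (y + w) + quartic (z + w)
      - quartic x - quartic y - quartic z - quartic w)

/-- `t` is the value `T(x, y, z)`: it represents the linear form `q(x, y, z, ·)`. -/
def IsTriple (x y z t : FMod c ℚ) : Prop := ∀ w, symp t w = quarticLin x y z w

/-- The trilinear operator `T`. -/
noncomputable def triple (x y z : FMod c ℚ) : FMod c ℚ := Classical.epsilon (IsTriple x y z)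

/-- The inclusion of the integral module into the rational one. -/
def toRat (x : FMod c ℤ) : FMod c ℚ := fun i => (x i : ℚ)

end Triple

/-! ### Gradient of the quartic form, and greatest common divisors -/

/-- The form `q'` as a polynomial in the natural coordinates: its value at the generic point. -/
noncomputable def quarticPoly (c : Coeff) : MvPolynomial (FIdx c) ℤ :=
  quartic' (fun i => MvPolynomial.X i : FMod c (MvPolynomial (FIdx c) ℤ))

/-- The formal gradient of `q'`, evaluated at an integral point. -/
noncomputable def grad {c : Coeff} (x : FMod c ℤ) : FIdx c → ℤ :=
  fun i => MvPolynomial.eval x (MvPolynomial.pderiv i (quarticPoly c))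

/-- Half the gradient; `/` is integer division. -/
noncomputable def halfGrad {c : Coeff} (x : FMod c ℤ) : FIdx c → ℤ := fun i => grad x i / 2

/-- The nonnegative greatest common divisor of the components of an integer vector. -/
def gcdVec {ι : Type*} [Fintype ι] (v : ι → ℤ) : ℤ := Finset.univ.gcd v

/-! ### The integral group and projective elements -/

/-- The group of invertible `ℤ`-linear maps of the integral module preserving `q` and the
skew-symmetric form. -/
def intGroup (c : Coeff) : Subgroup (FMod c ℤ ≃ₗ[ℤ] FMod c ℤ) where
  carrier := {g | (∀ x, quartic (g x) = quartic x) ∧ ∀ x y, symp (g x) (g y) = symp x y}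
  one_mem' := ⟨fun _ => rfl, fun _ _ => rfl⟩
  mul_mem' := by
    rintro g h ⟨hg1, hg2⟩ ⟨hh1, hh2⟩
    exact ⟨fun x => by rw [LinearEquiv.mul_apply, hg1, hh1],
      fun x y => by rw [LinearEquiv.mul_apply, LinearEquiv.mul_apply, hg2, hh2]⟩
  inv_mem' := by
    rintro g ⟨hg1, hg2⟩
    have key : ∀ x, g (g⁻¹ x) = x := fun x => g.apply_symm_apply x
    exact ⟨fun x => by rw [← hg1, key], fun x y => by rw [← hg2, key, key]⟩

/-- The three binary quadratic forms attached to
`(α, β, (a_0, a_1, a_2), (b_0, b_1, b_2))` are primitive. Indices are taken modulo `3`. -/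
def FormsPrimitive (α β : ℤ) (a b : Fin 3 → ℤ) : Prop :=
  ∀ i : Fin 3,
    gcdVec ![α * a i - b (i + 1) * b (i + 2),
      -(a i * b i) + a (i + 1) * b (i + 1) + a (i + 2) * b (i + 2) - α * β,
      β * b i - a (i + 1) * a (i + 2)] = 1

/-- The orbit of `x` under the integral group contains a diagonal reduced element
`(α, β, diag(a), 0)`, with `α > 0`, `α ∣ β`, `α ∣ a_i`, whose three binary quadratic forms
are primitive. -/
def OrbitProjective {c : Coeff} (x : FMod c ℤ) : Prop :=
  ∃ g ∈ intGroup c, ∃ (α β : ℤ) (a : Fin 3 → ℤ),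
    0 < α ∧ α ∣ β ∧ (∀ i, α ∣ a i) ∧
    g x = FMod.mk α β (Herm.diag c a) 0 ∧ FormsPrimitive α β a 0

/-- Projective elements of the integral Freudenthal module: by the three quadratic forms for
`J = ℤ ⊕ ℤ ⊕ ℤ`, and by a diagonal reduced element of the orbit in the other cases. -/
def IsProjective : {c : Coeff} → FMod c ℤ → Prop
  | .zero, x => FormsPrimitive x.α x.β x.A.d x.B.d
  | .bin, x => OrbitProjective x
  | .quat, x => OrbitProjective x
  | .oct, x => OrbitProjective x

end Freudenthal

open Freudenthal

/-! Write `halfDeriv x w` for half the derivative of `q'` at `x` in the direction `w`; it is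
integral because the first terms of `q'` carry a factor 4 and the last one is a square. Since `q =
-2q'`, polarization gives `q(x,x,x,w) = -halfDeriv x w`, so `T(x,x,x)` represents this linear form
through `symp`. The skew form is unimodular in the natural coordinates (`symp_dualBasis`), hence
`T(x,x,x)` is integral and an integer divides all its coordinates exactly when it divides all values
`halfDeriv x w`. This is the equality of the two gcds (`gcdVec_intTriple`).

The gcd is an invariant of the integral group, because `halfDeriv` is a combination of values of `q`
(`halfDeriv_apply`). So it can be computed on a normal form: every nonzero `x` is moved to a reduced
`(α, β, diag a, 0)` with `α` dividing `β` and all `a i` (`exists_diagonal_reduced`). The moves are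
the translations by rank one elements together with `swap`; their invariance rests on the adjoint
identity `sharp_sharp`. The least positive `α` in an orbit divides everything else, as in Euclid's
algorithm, and commutators of translations act on `A` as transvections, which diagonalize it.

On a reduced element the half gradient consists, up to sign, of `2 a₀a₁a₂ + αβ²`, `2α aⱼaₖ`, `αβ aᵢ`
and `α²β`, while the three forms have coefficients `α aᵢ`, `-αβ`, `-aⱼaₖ`. A common divisor of one
form divides the whole half gradient, so gcd 1 gives projectivity. Conversely primitive forms force
`α = 1`. If the gcd is 0 or at least 3, it is divisible by 4 or by an odd prime; either way some
prime divides `β` and every `aⱼaₖ`, and one form is not primitive.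

For the diagonal algebra projectivity is defined without orbits, so its invariance under the moves
is checked directly: they reverse or shear the binary forms. -/

namespace Freudenthal

/-! ### Identities of split composition algebras, checked in coordinates. -/

section CompositionIdentities

variable {R : Type*}

theorem bin_ext {x y : Comp .bin R} (h0 : x (0 : Fin 2) = y (0 : Fin 2))
    (h1 : x (1 : Fin 2) = y (1 : Fin 2)) : x = y := by
  funext (i : Fin 2)
  fin_cases i <;> assumption

theorem quat_ext {x y : Comp .quat R} (h0 : x (0 : Fin 4) = y (0 : Fin 4))
    (h1 : x (1 : Fin 4) = y (1 : Fin 4))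
    (h2 : x (2 : Fin 4) = y (2 : Fin 4)) (h3 : x (3 : Fin 4) = y (3 : Fin 4)) :
    x = y := by
  funext (i : Fin 4)
  fin_cases i <;> assumption

theorem oct_ext {x y : Comp .oct R} (h0 : x (0 : Fin 8) = y (0 : Fin 8))
    (h1 : x (1 : Fin 8) = y (1 : Fin 8))
    (h2 : x (2 : Fin 8) = y (2 : Fin 8)) (h3 : x (3 : Fin 8) = y (3 : Fin 8))
    (h4 : x (4 : Fin 8) = y (4 : Fin 8)) (h5 : x (5 : Fin 8) = y (5 : Fin 8))
    (h6 : x (6 : Fin 8) = y (6 : Fin 8)) (h7 : x (7 : Fin 8) = y (7 : Fin 8)) :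
    x = y := by
  funext (i : Fin 8)
  fin_cases i <;> assumption

variable [CommRing R]

/-! Coordinates of sums and multiples, with the index in the concrete type. -/

theorem bin_add_apply (x y : Comp .bin R) (i : Fin 2) :
    (x + y : Comp .bin R) i = x i + y i := rfl

theorem bin_sub_apply (x y : Comp .bin R) (i : Fin 2) :
    (x - y : Comp .bin R) i = x i - y i := rfl

theorem bin_smul_apply (k : R) (x : Comp .bin R) (i : Fin 2) :
    (k • x : Comp .bin R) i = k * x i := rfl

theorem quat_add_apply (x y : Comp .quat R) (i : Fin 4) :
    (x + y : Comp .quat R) i = x i + y i := rfl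

theorem quat_sub_apply (x y : Comp .quat R) (i : Fin 4) :
    (x - y : Comp .quat R) i = x i - y i := rfl

theorem quat_smul_apply (k : R) (x : Comp .quat R) (i : Fin 4) :
    (k • x : Comp .quat R) i = k * x i := rfl

theorem oct_add_apply (x y : Comp .oct R) (i : Fin 8) :
    (x + y : Comp .oct R) i = x i + y i := rfl

theorem oct_sub_apply (x y : Comp .oct R) (i : Fin 8) :
    (x - y : Comp .oct R) i = x i - y i := rfl

theorem oct_smul_apply (k : R) (x : Comp .oct R) (i : Fin 8) :
    (k • x : Comp .oct R) i = k * x i := rfl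

/-- The polarization `n(x + y) - n(x) - n(y)` of the norm, as the trace of `x * conj y`. -/
def compPolar (c : Coeff) (x y : Comp c R) : R := compTrace c (compMul c x (compConj c y))

theorem compMul_add_left (c : Coeff) (x y z : Comp c R) :
    compMul c (x + y) z = compMul c x z + compMul c y z := by
  cases c
  · exact Subsingleton.elim (α := Fin 0 → R) _ _
  · funext i; exact add_mul _ _ _
  · apply quat_ext <;>
      simp only [quat_add_apply] <;>
      simp [quat_add_apply, compMul, quatMul] <;> ring
  · apply oct_ext <;>
      simp only [oct_add_apply] <;>
      simp [oct_add_apply, compMul, quatMul, octMk, octFst, octSnd, quatConj] <;> ring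

theorem compMul_add_right (c : Coeff) (x y z : Comp c R) :
    compMul c x (y + z) = compMul c x y + compMul c x z := by
  cases c
  · exact Subsingleton.elim (α := Fin 0 → R) _ _
  · funext i; exact mul_add _ _ _
  · apply quat_ext <;>
      simp only [quat_add_apply] <;>
      simp [quat_add_apply, compMul, quatMul] <;> ring
  · apply oct_ext <;>
      simp only [oct_add_apply] <;>
      simp [oct_add_apply, compMul, quatMul, octMk, octFst, octSnd, quatConj] <;> ring

theorem compMul_smul_left (c : Coeff) (k : R) (x y : Comp c R) :
    compMul c (k • x) y = k • compMul c x y := by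
  cases c
  · exact Subsingleton.elim (α := Fin 0 → R) _ _
  · funext i; exact mul_assoc _ _ _
  · apply quat_ext <;>
      simp only [quat_smul_apply] <;>
      simp [quat_smul_apply, compMul, quatMul] <;> ring
  · apply oct_ext <;>
      simp only [oct_smul_apply] <;>
      simp [oct_smul_apply, compMul, quatMul, octMk, octFst, octSnd, quatConj] <;> ring

theorem compMul_smul_right (c : Coeff) (k : R) (x y : Comp c R) :
    compMul c x (k • y) = k • compMul c x y := by
  cases c
  · exact Subsingleton.elim (α := Fin 0 → R) _ _
  · funext i; exact mul_left_comm _ _ _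
  · apply quat_ext <;>
      simp only [quat_smul_apply] <;>
      simp [quat_smul_apply, compMul, quatMul] <;> ring
  · apply oct_ext <;>
      simp only [oct_smul_apply] <;>
      simp [oct_smul_apply, compMul, quatMul, octMk, octFst, octSnd, quatConj] <;> ring

theorem compConj_add (c : Coeff) (x y : Comp c R) :
    compConj c (x + y) = compConj c x + compConj c y := by
  cases c
  · exact Subsingleton.elim (α := Fin 0 → R) _ _
  · apply bin_ext <;> rfl
  · apply quat_ext <;>
      simp only [quat_add_apply] <;>
      simp [quat_add_apply, compConj, quatConj] <;> ring
  · apply oct_ext <;>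
      simp only [oct_add_apply] <;>
      simp [oct_add_apply, compConj, octMk, octFst, octSnd, quatConj] <;> ring

theorem compConj_smul (c : Coeff) (k : R) (x : Comp c R) :
    compConj c (k • x) = k • compConj c x := by
  cases c
  · exact Subsingleton.elim (α := Fin 0 → R) _ _
  · apply bin_ext <;> rfl
  · apply quat_ext <;>
      simp only [quat_smul_apply] <;>
      simp [quat_smul_apply, compConj, quatConj]
  · apply oct_ext <;>
      simp only [oct_smul_apply] <;>
      simp [oct_smul_apply, compConj, octMk, octFst, octSnd, quatConj]

theorem compTrace_add (c : Coeff) (x y : Comp c R) :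
    compTrace c (x + y) = compTrace c x + compTrace c y := by
  cases c <;> simp [bin_add_apply, quat_add_apply, oct_add_apply, compTrace] <;> ring

theorem compTrace_smul (c : Coeff) (k : R) (x : Comp c R) :
    compTrace c (k • x) = k * compTrace c x := by
  cases c <;> simp [bin_smul_apply, quat_smul_apply, oct_smul_apply, compTrace] <;> ring

theorem compPolar_comm (c : Coeff) (x y : Comp c R) : compPolar c x y = compPolar c y x := by
  cases c <;> simp [compPolar, compTrace, compMul, quatMul, octMk, octFst, octSnd, quatConj,
    compConj] <;> ring

theorem compNorm_add (c : Coeff) (x y : Comp c R) :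
    compNorm c (x + y) = compNorm c x + compNorm c y + compPolar c x y := by
  cases c <;> simp [bin_add_apply, quat_add_apply, oct_add_apply, compPolar, compTrace, compMul,
      quatMul, octMk, octFst, octSnd, quatConj,
    compConj, compNorm, quatNorm] <;> ring

theorem compNorm_smul (c : Coeff) (k : R) (x : Comp c R) :
    compNorm c (k • x) = k ^ 2 * compNorm c x := by
  cases c <;> simp [bin_smul_apply, quat_smul_apply, oct_smul_apply, octFst, octSnd, compNorm,
      quatNorm] <;> ring

theorem compPolar_self (c : Coeff) (x : Comp c R) : compPolar c x x = 2 * compNorm c x := by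
  cases c <;> simp [compPolar, compTrace, compMul, quatMul, octMk, octFst, octSnd, quatConj,
    compConj, compNorm, quatNorm] <;> ring

theorem compTrace_mul_cyclic (c : Coeff) (x y z : Comp c R) :
    compTrace c (compMul c (compMul c x y) z) = compTrace c (compMul c (compMul c y z) x) := by
  cases c <;> simp [compTrace, compMul, quatMul, octMk, octFst, octSnd, quatConj] <;> ring

theorem compPolar_conj_mul (c : Coeff) (x y z : Comp c R) :
    compPolar c (compConj c (compMul c x y)) z = compTrace c (compMul c (compMul c x y) z) := by
  cases c <;> simp [compPolar, compConj, compTrace, compMul, quatMul, octMk, octFst, octSnd,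
    quatConj] <;> ring

theorem compNorm_conj_mul (c : Coeff) (x y : Comp c R) :
    compNorm c (compConj c (compMul c x y)) = compNorm c x * compNorm c y := by
  cases c <;> simp [compConj, compNorm, quatNorm, compMul, quatMul, octMk, octFst, octSnd,
    quatConj] <;> ring

/-- The left side is `(x y) ȳ`, which alternativity turns into `n(y) x`; associativity is not
needed. -/
theorem compConj_mul_conj_right (c : Coeff) (x y : Comp c R) :
    compConj c (compMul c y (compConj c (compMul c x y))) = compNorm c y • x := by
  cases c
  · exact Subsingleton.elim (α := Fin 0 → R) _ _
  · apply bin_ext <;>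
      simp only [bin_smul_apply] <;>
      simp [compMul, compConj, compNorm] <;> ring
  · apply quat_ext <;>
      simp only [quat_smul_apply] <;>
      simp [compMul, compConj, compNorm, quatConj, quatMul, quatNorm] <;> ring
  · apply oct_ext <;>
      simp only [oct_smul_apply] <;>
      simp [compMul, compConj, compNorm, octMk, octFst, octSnd, quatConj, quatMul,
      quatNorm] <;> ring

theorem compConj_mul_conj_left (c : Coeff) (x z : Comp c R) :
    compConj c (compMul c (compConj c (compMul c z x)) z) = compNorm c z • x := by
  cases c
  · exact Subsingleton.elim (α := Fin 0 → R) _ _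
  · apply bin_ext <;>
      simp only [bin_smul_apply] <;>
      simp [compMul, compConj, compNorm] <;> ring
  · apply quat_ext <;>
      simp only [quat_smul_apply] <;>
      simp [compMul, compConj, compNorm, quatConj, quatMul, quatNorm] <;> ring
  · apply oct_ext <;>
      simp only [oct_smul_apply] <;>
      simp [compMul, compConj, compNorm, octMk, octFst, octSnd, quatConj, quatMul,
      quatNorm] <;> ring

set_option maxHeartbeats 4000000 in
/-- A form of the middle Moufang identity. -/
theorem compConj_mul_conj_conj (c : Coeff) (x y z : Comp c R) :
    compConj c (compMul c (compConj c (compMul c z x)) (compConj c (compMul c x y))) =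
      compTrace c (compMul c (compMul c x y) z) • x
        - compNorm c x • compConj c (compMul c y z) := by
  cases c
  · exact Subsingleton.elim (α := Fin 0 → R) _ _
  · apply bin_ext <;>
      simp only [bin_sub_apply, bin_smul_apply] <;>
      simp [compMul, compConj, compNorm, compTrace] <;> ring
  · apply quat_ext <;>
      simp only [quat_sub_apply, quat_smul_apply] <;>
      simp [compMul, compConj, compNorm, compTrace, quatConj, quatMul,
      quatNorm] <;> ring
  · apply oct_ext <;>
      simp only [oct_sub_apply, oct_smul_apply] <;>
      simp [compMul, compConj, compNorm, compTrace, octMk, octFst, octSnd,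
      quatConj, quatMul, quatNorm] <;> ring

end CompositionIdentities

/-! ### The cubic Jordan algebra: trace form, cross product, adjoint identity. -/

section JordanIdentities

variable {c : Coeff} {R : Type*} [CommRing R]

theorem compPolar_add_left (c : Coeff) (x y z : Comp c R) :
    compPolar c (x + y) z = compPolar c x z + compPolar c y z := by
  simp only [compPolar, compMul_add_left, compTrace_add]

theorem compPolar_smul_left (c : Coeff) (k : R) (x z : Comp c R) :
    compPolar c (k • x) z = k * compPolar c x z := by
  simp only [compPolar, compMul_smul_left, compTrace_smul]

theorem compPolar_smul_right (c : Coeff) (k : R) (x z : Comp c R) :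
    compPolar c x (k • z) = k * compPolar c x z := by
  simp only [compPolar_comm c x, compPolar_smul_left]

theorem Herm.ext' {A B : Herm c R} (hd : ∀ i, A.d i = B.d i) (ho : ∀ i, A.o i = B.o i) :
    A = B := by
  funext i
  rcases i with i | ⟨i, j⟩
  · exact hd i
  · exact congrFun (ho i) j

/-- The polarization of the adjoint. -/
def Herm.cross (A B : Herm c R) : Herm c R :=
  Sum.elim
    (fun i => A.d (i + 1) * B.d (i + 2) + B.d (i + 1) * A.d (i + 2) - compPolar c (A.o i) (B.o i))
    (fun p => (compConj c (compMul c (A.o (p.1 + 1)) (B.o (p.1 + 2)))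
      + compConj c (compMul c (B.o (p.1 + 1)) (A.o (p.1 + 2)))
      - A.d p.1 • B.o p.1 - B.d p.1 • A.o p.1) p.2)

namespace Herm

@[simp] theorem d_add (A B : Herm c R) (i : Fin 3) : (A + B).d i = A.d i + B.d i := rfl
@[simp] theorem d_sub (A B : Herm c R) (i : Fin 3) : (A - B).d i = A.d i - B.d i := rfl
@[simp] theorem d_neg (A : Herm c R) (i : Fin 3) : (-A).d i = -A.d i := rfl
@[simp] theorem d_smul (k : R) (A : Herm c R) (i : Fin 3) : (k • A).d i = k * A.d i := rfl
@[simp] theorem d_zero (i : Fin 3) : (0 : Herm c R).d i = 0 := rfl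
@[simp] theorem o_add (A B : Herm c R) (i : Fin 3) : (A + B).o i = A.o i + B.o i := rfl
@[simp] theorem o_sub (A B : Herm c R) (i : Fin 3) : (A - B).o i = A.o i - B.o i := rfl
@[simp] theorem o_neg (A : Herm c R) (i : Fin 3) : (-A).o i = -A.o i := rfl
@[simp] theorem o_smul (k : R) (A : Herm c R) (i : Fin 3) : (k • A).o i = k • A.o i := rfl
@[simp] theorem o_zero (i : Fin 3) : (0 : Herm c R).o i = 0 := rfl

@[simp] theorem d_sharp (A : Herm c R) (i : Fin 3) :
    A.sharp.d i = A.d (i + 1) * A.d (i + 2) - compNorm c (A.o i) := rfl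

@[simp] theorem o_sharp (A : Herm c R) (i : Fin 3) :
    A.sharp.o i = compConj c (compMul c (A.o (i + 1)) (A.o (i + 2))) - A.d i • A.o i := rfl

@[simp] theorem d_cross (A B : Herm c R) (i : Fin 3) :
    (A.cross B).d i = A.d (i + 1) * B.d (i + 2) + B.d (i + 1) * A.d (i + 2)
      - compPolar c (A.o i) (B.o i) := rfl

@[simp] theorem o_cross (A B : Herm c R) (i : Fin 3) :
    (A.cross B).o i = compConj c (compMul c (A.o (i + 1)) (B.o (i + 2)))
      + compConj c (compMul c (B.o (i + 1)) (A.o (i + 2))) - A.d i • B.o i - B.d i • A.o i := rfl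

theorem tr_eq (A B : Herm c R) :
    tr A B = A.d 0 * B.d 0 + A.d 1 * B.d 1 + A.d 2 * B.d 2 + compPolar c (A.o 0) (B.o 0)
      + compPolar c (A.o 1) (B.o 1) + compPolar c (A.o 2) (B.o 2) := by
  simp only [tr, Fin.sum_univ_three, compPolar]
  ring

theorem tr_comm (A B : Herm c R) : tr A B = tr B A := by
  simp only [tr_eq, compPolar_comm c (A.o _)]
  ring

theorem tr_add_left (A B C : Herm c R) : tr (A + B) C = tr A C + tr B C := by
  simp only [tr_eq, d_add, o_add, compPolar_add_left]
  ring

theorem tr_smul_left (k : R) (A B : Herm c R) : tr (k • A) B = k * tr A B := by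
  simp only [tr_eq, d_smul, o_smul, compPolar_smul_left]
  ring

theorem tr_add_right (A B C : Herm c R) : tr A (B + C) = tr A B + tr A C := by
  simp only [tr_comm A, tr_add_left]

theorem tr_smul_right (k : R) (A B : Herm c R) : tr A (k • B) = k * tr A B := by
  simp only [tr_comm A, tr_smul_left]

theorem tr_neg_left (A B : Herm c R) : tr (-A) B = -tr A B := by
  rw [← neg_one_smul R A, tr_smul_left, neg_one_mul]

theorem tr_neg_right (A B : Herm c R) : tr A (-B) = -tr A B := by
  rw [tr_comm, tr_neg_left, tr_comm]

theorem tr_zero_left (A : Herm c R) : tr 0 A = 0 := by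
  rw [← zero_smul R (0 : Herm c R), tr_smul_left, zero_mul]

theorem tr_zero_right (A : Herm c R) : tr A 0 = 0 := by rw [tr_comm, tr_zero_left]

theorem cross_comm (A B : Herm c R) : cross A B = cross B A := by
  refine ext' (fun i => ?_) fun i => ?_
  · simp only [d_cross, compPolar_comm c (A.o _)]
    ring
  · simp only [o_cross]
    abel

theorem cross_add_left (A B C : Herm c R) : cross (A + B) C = cross A C + cross B C := by
  refine ext' (fun i => ?_) fun i => ?_
  · simp only [d_cross, d_add, o_add, compPolar_add_left]
    ring
  · simp only [o_cross, d_add, o_add, compMul_add_left, compMul_add_right, compConj_add]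
    module

theorem cross_smul_left (k : R) (A C : Herm c R) : cross (k • A) C = k • cross A C := by
  refine ext' (fun i => ?_) fun i => ?_
  · simp only [d_cross, d_smul, o_smul, compPolar_smul_left]
    ring
  · simp only [o_cross, d_smul, o_smul, compMul_smul_left, compMul_smul_right, compConj_smul]
    module

theorem cross_add_right (A B C : Herm c R) : cross A (B + C) = cross A B + cross A C := by
  simp only [cross_comm A, cross_add_left]

theorem cross_smul_right (k : R) (A C : Herm c R) : cross A (k • C) = k • cross A C := by
  simp only [cross_comm A, cross_smul_left]

theorem cross_neg_left (A B : Herm c R) : cross (-A) B = -cross A B := by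
  rw [← neg_one_smul R A, cross_smul_left, neg_one_smul]

theorem cross_neg_right (A B : Herm c R) : cross A (-B) = -cross A B := by
  rw [cross_comm, cross_neg_left, cross_comm]

theorem cross_zero_left (A : Herm c R) : cross 0 A = 0 := by
  simpa using cross_smul_left (0 : R) (0 : Herm c R) A

theorem sharp_add (A B : Herm c R) : sharp (A + B) = sharp A + sharp B + cross A B := by
  refine ext' (fun i => ?_) fun i => ?_
  · simp only [d_cross, d_sharp, d_add, o_add, compNorm_add]
    ring
  · simp only [o_cross, o_sharp, d_add, o_add, compMul_add_left, compMul_add_right, compConj_add]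
    module

theorem sharp_smul (k : R) (A : Herm c R) : sharp (k • A) = k ^ 2 • sharp A := by
  refine ext' (fun i => ?_) fun i => ?_
  · simp only [d_sharp, d_smul, o_smul, compNorm_smul]
    ring
  · simp only [o_sharp, d_smul, o_smul, compMul_smul_left, compMul_smul_right, compConj_smul]
    module

theorem cross_self (A : Herm c R) : cross A A = (2 : R) • sharp A := by
  refine ext' (fun i => ?_) fun i => ?_
  · simp only [d_cross, d_sharp, d_smul, compPolar_self]
    ring
  · simp only [o_cross, o_sharp, o_smul]
    module

/-- Rotates cubic traces into the order of indices 0, 1, 2, a normal form in which `ring` can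
compare them. -/
theorem compTrace_mul_o_one (X Y Z : Herm c R) :
    compTrace c (compMul c (compMul c (X.o 1) (Y.o 2)) (Z.o 0)) =
      compTrace c (compMul c (compMul c (Z.o 0) (X.o 1)) (Y.o 2)) :=
  (compTrace_mul_cyclic c _ _ _).symm

theorem compTrace_mul_o_two (X Y Z : Herm c R) :
    compTrace c (compMul c (compMul c (X.o 2) (Y.o 0)) (Z.o 1)) =
      compTrace c (compMul c (compMul c (Y.o 0) (Z.o 1)) (X.o 2)) :=
  compTrace_mul_cyclic c _ _ _

/-- `tr (A × B) C` is the full linearization `6N(A,B,C)` of the norm, hence symmetric. -/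
theorem tr_cross_cyclic (A B C : Herm c R) : tr (cross A B) C = tr (cross B C) A := by
  simp only [tr_eq, d_cross, o_cross, sub_eq_add_neg, ← neg_smul, compPolar_add_left,
    compPolar_smul_left, Fin.reduceAdd, Fin.isValue, zero_add, compPolar_conj_mul,
    compTrace_mul_o_one, compTrace_mul_o_two]
  rw [compPolar_comm c (C.o 0) (A.o 0), compPolar_comm c (C.o 1) (A.o 1),
    compPolar_comm c (C.o 2) (A.o 2), compPolar_comm c (B.o 0) (A.o 0),
    compPolar_comm c (B.o 1) (A.o 1), compPolar_comm c (B.o 2) (A.o 2)]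
  ring

theorem norm_eq (A : Herm c R) :
    A.norm = A.d 0 * A.d 1 * A.d 2 - A.d 0 * compNorm c (A.o 0) - A.d 1 * compNorm c (A.o 1)
      - A.d 2 * compNorm c (A.o 2)
      + compTrace c (compMul c (compMul c (A.o 0) (A.o 1)) (A.o 2)) := by
  simp only [norm, Fin.sum_univ_three]
  ring

theorem norm_add (A B : Herm c R) :
    norm (A + B) = norm A + tr (sharp A) B + tr A (sharp B) + norm B := by
  rw [tr_comm A]
  simp only [norm_eq, tr_eq, d_sharp, o_sharp, d_add, o_add, compNorm_add, compMul_add_left,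
    compMul_add_right, compTrace_add, sub_eq_add_neg, ← neg_smul, compPolar_add_left,
    compPolar_smul_left, Fin.reduceAdd, Fin.isValue, zero_add, compPolar_conj_mul,
    compTrace_mul_o_one, compTrace_mul_o_two]
  rw [compPolar_comm c (B.o 0) (A.o 0), compPolar_comm c (B.o 1) (A.o 1),
    compPolar_comm c (B.o 2) (A.o 2)]
  ring

theorem norm_smul (k : R) (A : Herm c R) : norm (k • A) = k ^ 3 * norm A := by
  simp only [norm_eq, d_smul, o_smul, compNorm_smul, compMul_smul_left, compMul_smul_right,
    compTrace_smul]
  ring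

theorem tr_sharp_self (A : Herm c R) : tr (sharp A) A = 3 * norm A := by
  simp only [norm_eq, tr_eq, d_sharp, o_sharp, sub_eq_add_neg, ← neg_smul, compPolar_add_left,
    compPolar_smul_left, compPolar_self, Fin.reduceAdd, Fin.isValue, zero_add,
    compPolar_conj_mul, compTrace_mul_o_one, compTrace_mul_o_two]
  ring

/-- The adjoint identity. -/
theorem sharp_sharp (A : Herm c R) : sharp (sharp A) = norm A • A := by
  -- `key` treats one off-diagonal entry and `key'` one diagonal entry; the others follow by
  -- rotating the three indices, which leaves the norm unchanged.
  have key (x y z : Comp c R) (a b d : R) :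
      compConj c (compMul c (compConj c (compMul c z x) - a • y)
          (compConj c (compMul c x y) - b • z))
        - (a * b - compNorm c x) • (compConj c (compMul c y z) - d • x)
      = (d * a * b - d * compNorm c x - a * compNorm c y - b * compNorm c z
        + compTrace c (compMul c (compMul c x y) z)) • x := by
    simp only [sub_eq_add_neg, ← neg_smul, compMul_add_left, compMul_add_right, compConj_add,
      compMul_smul_left, compMul_smul_right, compConj_smul, compConj_mul_conj_conj,
      compConj_mul_conj_left, compConj_mul_conj_right]
    module
  have key' (x y z : Comp c R) (a b d : R) :
      (b * d - compNorm c y) * (d * a - compNorm c z)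
        - compNorm c (compConj c (compMul c y z) - d • x) = (d * a * b - d * compNorm c x
          - a * compNorm c y - b * compNorm c z
        + compTrace c (compMul c (compMul c x y) z)) * d := by
    rw [sub_eq_add_neg _ (d • x), ← neg_smul, compNorm_add, compNorm_smul, compNorm_conj_mul,
      compPolar_smul_right, compPolar_conj_mul, compTrace_mul_cyclic c x]
    ring
  refine ext' (fun i => ?_) fun i => ?_
  · fin_cases i
    · simp [norm_eq]
      rw [key']
    · simp [norm_eq]
      rw [key', compTrace_mul_cyclic c (A.o 0)]
      ring
    · simp [norm_eq]
      rw [key', ← compTrace_mul_cyclic c (A.o 2)]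
      ring
  · fin_cases i
    · simp [norm_eq]
      rw [key]
    · simp [norm_eq]
      rw [key, compTrace_mul_cyclic c (A.o 0)]
      module
    · simp [norm_eq]
      rw [key, ← compTrace_mul_cyclic c (A.o 2)]
      module

end Herm
end JordanIdentities

/-! ### Components of elements of the Freudenthal module. -/

section Coordinates

variable {c : Coeff} {R : Type*} [CommRing R]

namespace FMod

@[simp] theorem α_add (x y : FMod c R) : (x + y).α = x.α + y.α := rfl
@[simp] theorem β_add (x y : FMod c R) : (x + y).β = x.β + y.β := rfl
@[simp] theorem A_add (x y : FMod c R) : (x + y).A = x.A + y.A := rfl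
@[simp] theorem B_add (x y : FMod c R) : (x + y).B = x.B + y.B := rfl
@[simp] theorem α_neg (x : FMod c R) : (-x).α = -x.α := rfl
@[simp] theorem β_neg (x : FMod c R) : (-x).β = -x.β := rfl
@[simp] theorem A_neg (x : FMod c R) : (-x).A = -x.A := rfl
@[simp] theorem B_neg (x : FMod c R) : (-x).B = -x.B := rfl
@[simp] theorem α_smul (k : R) (x : FMod c R) : (k • x).α = k * x.α := rfl
@[simp] theorem β_smul (k : R) (x : FMod c R) : (k • x).β = k * x.β := rfl
@[simp] theorem A_smul (k : R) (x : FMod c R) : (k • x).A = k • x.A := rfl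
@[simp] theorem B_smul (k : R) (x : FMod c R) : (k • x).B = k • x.B := rfl
@[simp] theorem α_mk (α β : R) (A B : Herm c R) : (mk α β A B).α = α := rfl
@[simp] theorem β_mk (α β : R) (A B : Herm c R) : (mk α β A B).β = β := rfl
@[simp] theorem A_mk (α β : R) (A B : Herm c R) : (mk α β A B).A = A := rfl
@[simp] theorem B_mk (α β : R) (A B : Herm c R) : (mk α β A B).B = B := rfl

theorem ext' {x y : FMod c R} (h1 : x.α = y.α) (h2 : x.β = y.β) (h3 : x.A = y.A)
    (h4 : x.B = y.B) : x = y := by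
  funext i
  rcases i with i | i | i
  · fin_cases i
    · exact h1
    · exact h2
  · exact congrFun h3 i
  · exact congrFun h4 i

end FMod
end Coordinates

/-! ### Translations by rank one elements, and the swap, in the integral group. -/

section RankOne

variable {c : Coeff}

namespace Herm

theorem norm_eq_zero_of_sharp {C : Herm c ℤ} (hC : C.sharp = 0) : C.norm = 0 := by
  have h := tr_sharp_self C
  rw [hC, tr_zero_left] at h
  omega

/-- Apply the adjoint identity to `A + C` and `A - C`: as `C` has zero adjoint and norm, the part
odd in `C` is the first identity and the even part is the second. -/
theorem sharp_identities {C : Herm c ℤ} (hC : C.sharp = 0) (A : Herm c ℤ) :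
    cross A.sharp (cross A C) = A.norm • C + tr A.sharp C • A ∧
      sharp (cross A C) = tr A.sharp C • C := by
  have h1 := sharp_sharp (A + C)
  have h2 := sharp_sharp (A + (-1 : ℤ) • C)
  simp only [sharp_add, sharp_smul, norm_add, norm_smul, cross_smul_right,
    hC, smul_zero, norm_eq_zero_of_sharp hC, sharp_sharp, add_zero,
    tr_smul_right, tr_zero_right, mul_zero] at h1 h2
  constructor
  · funext i
    have e1 := congrFun h1 i
    have e2 := congrFun h2 i
    simp only [Pi.add_apply, Pi.smul_apply, smul_eq_mul] at e1 e2 ⊢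
    linarith
  · funext i
    have e1 := congrFun h1 i
    have e2 := congrFun h2 i
    simp only [Pi.add_apply, Pi.smul_apply, smul_eq_mul] at e1 e2 ⊢
    linarith

theorem cross_self_eq_zero {C : Herm c ℤ} (hC : C.sharp = 0) : cross C C = 0 := by
  rw [cross_self, hC, smul_zero]

theorem tr_cross_self_right {C : Herm c ℤ} (hC : C.sharp = 0) (A : Herm c ℤ) :
    tr (cross A C) C = 0 := by
  rw [tr_cross_cyclic, cross_self_eq_zero hC, tr_zero_left]

end Herm

open Herm

/-- The elementary transformation attached to `C`, for `C` of rank at most one. -/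
def transMap (C : Herm c ℤ) : FMod c ℤ →ₗ[ℤ] FMod c ℤ where
  toFun x := FMod.mk (x.α + tr x.B C) x.β (x.A + x.β • C) (x.B + cross x.A C)
  map_add' x y := by
    apply FMod.ext'
    · simp [tr_add_left]; ring
    · simp
    · simp only [FMod.A_mk, FMod.A_add, FMod.β_add]; module
    · simp only [FMod.B_mk, FMod.A_add, FMod.B_add, cross_add_left]; module
  map_smul' k x := by
    apply FMod.ext'
    · simp [tr_smul_left, -zsmul_eq_mul]; ring
    · simp [-zsmul_eq_mul]
    · simp only [FMod.A_mk, FMod.A_smul, FMod.β_smul, RingHom.id_apply]; module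
    · simp only [FMod.B_mk, FMod.A_smul, FMod.B_smul, cross_smul_left, RingHom.id_apply]; module

/-- The terms quadratic in `C` are `tr (A × C) C` and `C × C`; both vanish because `C × C` is twice
the adjoint of `C`. -/
theorem transMap_neg {C : Herm c ℤ} (hC : C.sharp = 0) (x : FMod c ℤ) :
    transMap (-C) (transMap C x) = x := by
  apply FMod.ext'
  · simp [transMap, tr_add_left, tr_neg_right, tr_cross_self_right hC]
  · simp [transMap]
  · simp [transMap]
  · simp [transMap, cross_add_left, cross_smul_left, cross_neg_right, cross_self_eq_zero hC,
        -zsmul_eq_mul]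

theorem Herm.sharp_neg (C : Herm c ℤ) : (-C).sharp = C.sharp := by
  rw [← neg_one_smul ℤ C, sharp_smul]
  simp

/-- The elementary transformation attached to `C` of rank at most one, as an equivalence. -/
def trans (C : Herm c ℤ) (hC : C.sharp = 0) : FMod c ℤ ≃ₗ[ℤ] FMod c ℤ :=
  LinearEquiv.ofLinearMap (transMap C) (transMap (-C))
    (LinearMap.ext fun x => by
      have h := transMap_neg (C := -C) (by rw [Herm.sharp_neg, hC]) x
      rwa [neg_neg] at h)
    (LinearMap.ext fun x => transMap_neg hC x)

@[simp] theorem trans_apply (C : Herm c ℤ) (hC : C.sharp = 0) (x : FMod c ℤ) :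
    trans C hC x = FMod.mk (x.α + tr x.B C) x.β (x.A + x.β • C) (x.B + cross x.A C) := rfl

/-- Freudenthal's translation also has terms in the adjoint and norm of `C`, absent in rank one.
After expansion, invariance of `q` reduces to the contractions `h3` to `h6`, which come from
`sharp_identities` and the symmetry of the trilinear form. -/
theorem trans_mem (C : Herm c ℤ) (hC : C.sharp = 0) : trans C hC ∈ intGroup c := by
  constructor
  · intro x
    obtain ⟨h1, h2⟩ := sharp_identities hC x.A
    have h3 : Herm.norm (cross x.A C) = 0 := by
      have h := tr_sharp_self (cross x.A C)
      rw [h2, tr_smul_left, tr_comm C, tr_cross_self_right hC] at h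
      omega
    have h4 : tr x.A.sharp (cross x.B (cross x.A C)) =
        x.A.norm * tr x.B C + tr x.A.sharp C * tr x.A x.B := by
      rw [tr_comm, tr_cross_cyclic, cross_comm, h1, tr_add_left, tr_smul_left, tr_smul_left,
        tr_comm C]
    have h5 : tr (cross x.A C) (cross x.B (cross x.A C)) = 2 * (tr x.A.sharp C * tr x.B C) := by
      rw [tr_comm, tr_cross_cyclic, Herm.cross_self, h2, tr_smul_left, tr_smul_left, tr_comm C]
    have h6 : tr x.A (cross x.A C) = 2 * tr x.A.sharp C := by
      rw [tr_comm, tr_cross_cyclic, tr_cross_cyclic, Herm.cross_self, tr_smul_left]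
    simp only [quartic, quartic', trans_apply, FMod.α_mk, FMod.β_mk, FMod.A_mk, FMod.B_mk,
      sharp_add, Herm.norm_add, Herm.norm_smul, sharp_smul, hC, h2, smul_zero, add_zero, h3,
      norm_eq_zero_of_sharp hC, cross_smul_right, tr_add_left, tr_add_right, tr_smul_left,
      tr_smul_right, tr_zero_right, h4, h5, h6, tr_cross_self_right hC,
      tr_comm C x.B, tr_comm C (cross x.A C), tr_comm (cross x.A C) x.B.sharp]
    ring
  · intro x y
    have h1 : tr x.A (cross y.A C) = tr (cross x.A C) y.A := by
      rw [tr_cross_cyclic, cross_comm C, tr_comm]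
    simp only [symp, trans_apply, FMod.α_mk, FMod.β_mk, FMod.A_mk, FMod.B_mk, tr_add_left,
      tr_add_right, tr_smul_left, tr_smul_right, tr_cross_self_right hC, h1,
      tr_comm C (cross y.A C), tr_comm C y.B]
    ring

/-- The map `(α, β, A, B) ↦ (-β, α, -B, A)`. -/
def swapMap : FMod c ℤ →ₗ[ℤ] FMod c ℤ where
  toFun x := FMod.mk (-x.β) x.α (-x.B) x.A
  map_add' x y := by
    apply FMod.ext'
    · simp; ring
    · simp
    · simp only [FMod.A_mk, FMod.A_add, FMod.B_add]; module
    · simp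
  map_smul' k x := by
    apply FMod.ext' <;> simp [-zsmul_eq_mul]

/-- The map `(α, β, A, B) ↦ (-β, α, -B, A)`, as an equivalence. -/
def swap (c : Coeff) : FMod c ℤ ≃ₗ[ℤ] FMod c ℤ :=
  LinearEquiv.ofLinearMap swapMap ((-1 : ℤ) • swapMap)
    (LinearMap.ext fun x => by apply FMod.ext' <;> simp [swapMap])
    (LinearMap.ext fun x => by apply FMod.ext' <;> simp [swapMap])

@[simp] theorem swap_apply (x : FMod c ℤ) : swap c x = FMod.mk (-x.β) x.α (-x.B) x.A := rfl

theorem Herm.norm_neg (C : Herm c ℤ) : (-C).norm = -C.norm := by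
  rw [← neg_one_smul ℤ C, Herm.norm_smul]
  ring

theorem swap_mem (c : Coeff) : swap c ∈ intGroup c := by
  constructor
  · intro x
    simp only [quartic, quartic', swap_apply, FMod.α_mk, FMod.β_mk, FMod.A_mk, FMod.B_mk,
      Herm.sharp_neg, Herm.norm_neg, tr_neg_left, tr_comm x.B, tr_comm x.B.sharp]
    ring
  · intro x y
    simp only [symp, swap_apply, FMod.α_mk, FMod.β_mk, FMod.A_mk, FMod.B_mk, tr_neg_left,
      tr_neg_right]
    ring

end RankOne

/-! ### Integral dual bases made of rank one elements. -/

section Duality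

/-- The coordinate that is dual to a given one for the polarized norm. -/
def compFlip : (c : Coeff) → Fin c.dim → Fin c.dim
  | .zero, j => j
  | .bin, j => (![1, 0] : Fin 2 → Fin 2) j
  | .quat, j => (![3, 2, 1, 0] : Fin 4 → Fin 4) j
  | .oct, j => (![3, 2, 1, 0, 7, 6, 5, 4] : Fin 8 → Fin 8) j

/-- The sign that goes with `compFlip`. -/
def compSign : (c : Coeff) → Fin c.dim → ℤ
  | .zero, _ => 1
  | .bin, _ => 1
  | .quat, j => (![1, -1, -1, 1] : Fin 4 → ℤ) j
  | .oct, j => (![1, -1, -1, 1, 1, -1, -1, 1] : Fin 8 → ℤ) j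

variable {c : Coeff} {R : Type*} [CommRing R]

theorem compMul_zero_left (c : Coeff) (x : Comp c R) : compMul c 0 x = 0 := by
  simpa using compMul_smul_left c (0 : R) 0 x

theorem compMul_zero_right (c : Coeff) (x : Comp c R) : compMul c x 0 = 0 := by
  simpa using compMul_smul_right c (0 : R) x 0

theorem compConj_zero (c : Coeff) : compConj c (0 : Comp c R) = 0 := by
  simpa using compConj_smul c (0 : R) 0

theorem compNorm_zero (c : Coeff) : compNorm c (0 : Comp c R) = 0 := by
  simpa using compNorm_smul c (0 : R) 0

theorem compPolar_zero_left (c : Coeff) (x : Comp c R) : compPolar c 0 x = 0 := by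
  simpa using compPolar_smul_left c (0 : R) 0 x

theorem compPolar_zero_right (c : Coeff) (x : Comp c R) : compPolar c x 0 = 0 := by
  simpa using compPolar_smul_right c (0 : R) x 0

theorem compPolar_single (c : Coeff) (x : Comp c R) (j : Fin c.dim) (k : R) :
    compPolar c x (Pi.single (compFlip c j) ((compSign c j : R) * k)) = k * x j := by
  cases c
  · exact j.elim0
  · change Fin 2 at j
    change Fin 2 → R at x
    change compTrace .bin (compMul .bin x (compConj .bin
      (Pi.single ((![1, 0] : Fin 2 → Fin 2) j) _ : Fin 2 → R))) = _
    fin_cases j <;> simp [compTrace, compMul, compConj, compSign, mul_comm]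
  · change Fin 4 at j
    change Fin 4 → R at x
    change compTrace .quat (compMul .quat x (compConj .quat
      (Pi.single ((![3, 2, 1, 0] : Fin 4 → Fin 4) j) _ : Fin 4 → R))) = _
    fin_cases j <;> simp [compTrace, compMul, quatMul, quatConj, compConj, compSign, mul_comm]
  · change Fin 8 at j
    change Fin 8 → R at x
    change compTrace .oct (compMul .oct x (compConj .oct
      (Pi.single ((![3, 2, 1, 0, 7, 6, 5, 4] : Fin 8 → Fin 8) j) _ : Fin 8 → R))) = _
    fin_cases j <;> simp [compTrace, compMul, quatMul, quatConj, compConj, compSign, octMk,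
      octFst, octSnd, mul_comm]

/-- Here splitness enters: the coordinate vectors are isotropic, so all of them yield rank one
elements and translations. -/
theorem compNorm_single (c : Coeff) (j : Fin c.dim) (k : R) :
    compNorm c (Pi.single j k) = 0 := by
  cases c
  · exact j.elim0
  · change Fin 2 at j
    change compNorm .bin (Pi.single j k : Fin 2 → R) = 0
    fin_cases j <;> simp [compNorm]
  · change Fin 4 at j
    change compNorm .quat (Pi.single j k : Fin 4 → R) = 0
    fin_cases j <;> simp [compNorm, quatNorm]
  · change Fin 8 at j
    change compNorm .oct (Pi.single j k : Fin 8 → R) = 0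
    fin_cases j <;> simp [compNorm, quatNorm, octFst, octSnd]

namespace Herm

theorem d_single_inl (i j : Fin 3) (k : R) :
    Herm.d (c := c) (Pi.single (Sum.inl i) k) j = if j = i then k else 0 := by
  simp [Herm.d, Pi.single_apply]

theorem o_single_inl (i j : Fin 3) (k : R) :
    Herm.o (c := c) (Pi.single (Sum.inl i) k) j = 0 := by
  funext t
  simp [Herm.o]

theorem d_single_inr (p : Fin 3 × Fin c.dim) (j : Fin 3) (k : R) :
    Herm.d (c := c) (Pi.single (Sum.inr p) k) j = 0 := by
  simp [Herm.d]

theorem o_single_inr (i : Fin 3) (t : Fin c.dim) (j : Fin 3) (k : R) :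
    Herm.o (c := c) (Pi.single (Sum.inr (i, t)) k) j = if j = i then Pi.single t k else 0 := by
  funext s
  by_cases h : j = i <;> simp [Herm.o, Pi.single_apply, h]

theorem sharp_single (p : HermIdx c) (k : R) : sharp (Pi.single p k : Herm c R) = 0 := by
  rcases p with i | ⟨i, t⟩
  · refine ext' (fun j => ?_) fun j => ?_
    · fin_cases i <;> fin_cases j <;> simp [d_single_inl, o_single_inl, compNorm_zero]
    · simp [d_single_inl, o_single_inl, compMul_zero_left, compConj_zero]
  · refine ext' (fun j => ?_) fun j => ?_
    · by_cases h : j = i <;> simp [d_single_inr, o_single_inr, compNorm_zero, h, compNorm_single]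
    · fin_cases i <;> fin_cases j <;>
        simp [d_single_inr, o_single_inr, compMul_zero_left, compMul_zero_right, compConj_zero]

/-- The element of the dual basis for the trace form, times `k`. -/
def dualSingle : HermIdx c → R → Herm c R
  | .inl i, k => Pi.single (Sum.inl i) k
  | .inr (i, t), k => Pi.single (Sum.inr (i, compFlip c t)) ((compSign c t : R) * k)

/-- Dual basis vectors are multiples of coordinate vectors, so there are translations along them;
pairing with one extracts a single coordinate. -/
theorem dualSingle_eq_single (p : HermIdx c) (k : R) :
    ∃ q l, dualSingle p k = (Pi.single q l : Herm c R) := by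
  rcases p with i | ⟨i, t⟩
  · exact ⟨_, _, rfl⟩
  · exact ⟨_, _, rfl⟩

theorem tr_dualSingle (A : Herm c R) (p : HermIdx c) (k : R) :
    tr A (dualSingle p k) = k * A p := by
  rcases p with i | ⟨i, t⟩
  · fin_cases i <;> simp [dualSingle, tr_eq, o_single_inl, compPolar_zero_right,
      Herm.d, mul_comm]
  · fin_cases i <;> simp [dualSingle, tr_eq, d_single_inr, o_single_inr, compPolar_zero_right,
      compPolar_single] <;> rfl

end Herm
end Duality

open Herm

/-! ### Elementary orbits and reduction by the least positive `α`. -/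

section Orbits

variable {c : Coeff}

/-- The subgroup generated by the elementary transformations along the coordinate axes and
the map `(α, β, A, B) ↦ (-β, α, -B, A)`. -/
def elemGroup (c : Coeff) : Subgroup (FMod c ℤ ≃ₗ[ℤ] FMod c ℤ) :=
  Subgroup.closure ({swap c} ∪ {g | ∃ p k, g = trans (Pi.single p k) (sharp_single p k)})

theorem elemGroup_le (c : Coeff) : elemGroup c ≤ intGroup c := by
  rw [elemGroup, Subgroup.closure_le]
  rintro g (rfl | ⟨p, k, rfl⟩)
  · exact swap_mem c
  · exact trans_mem _ _

/-- Two elements are related by the group of elementary transformations. -/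
def Equivalent (x y : FMod c ℤ) : Prop := ∃ g ∈ elemGroup c, g x = y

theorem Equivalent.refl (x : FMod c ℤ) : Equivalent x x := ⟨1, one_mem _, rfl⟩

theorem Equivalent.trans {x y z : FMod c ℤ} (h₁ : Equivalent x y) (h₂ : Equivalent y z) :
    Equivalent x z := by
  obtain ⟨g, hg, rfl⟩ := h₁
  obtain ⟨h, hh, rfl⟩ := h₂
  exact ⟨h * g, mul_mem hh hg, rfl⟩

theorem Equivalent.symm {x y : FMod c ℤ} (h : Equivalent x y) : Equivalent y x := by
  obtain ⟨g, hg, rfl⟩ := h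
  exact ⟨g⁻¹, inv_mem hg, g.symm_apply_apply x⟩

theorem equivalent_swap (x : FMod c ℤ) : Equivalent x (FMod.mk (-x.β) x.α (-x.B) x.A) :=
  ⟨swap c, Subgroup.subset_closure (Or.inl rfl), rfl⟩

theorem equivalent_trans (x : FMod c ℤ) (p : HermIdx c) (k : ℤ) :
    Equivalent x (FMod.mk (x.α + tr x.B (Pi.single p k)) x.β (x.A + x.β • Pi.single p k)
      (x.B + cross x.A (Pi.single p k))) :=
  ⟨trans (Pi.single p k) (sharp_single p k), Subgroup.subset_closure (Or.inr ⟨p, k, rfl⟩), rfl⟩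

/-- The opposite translation, obtained by conjugating a translation with parameter `-k` by the swap.
-/
theorem equivalent_dual (x : FMod c ℤ) (p : HermIdx c) (k : ℤ) :
    Equivalent x (FMod.mk x.α (x.β + tr x.A (Pi.single p k)) (x.A + cross x.B (Pi.single p k))
      (x.B + x.α • Pi.single p k)) := by
  refine ((equivalent_swap x).trans (equivalent_trans _ p (-k))).trans (Equivalent.symm ?_)
  have h := equivalent_swap (FMod.mk x.α (x.β + tr x.A (Pi.single p k))
    (x.A + cross x.B (Pi.single p k)) (x.B + x.α • Pi.single p k))
  convert h using 1
  simp only [FMod.α_mk, FMod.β_mk, FMod.A_mk, FMod.B_mk, Pi.single_neg, tr_neg_right,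
    cross_neg_right, cross_neg_left]
  congr 1
  · ring
  · module
  · module

theorem equivalent_neg (x : FMod c ℤ) : Equivalent x (-x) := by
  refine ((equivalent_swap x).trans (equivalent_swap _)).trans ?_
  convert Equivalent.refl _ using 1
  apply FMod.ext' <;> simp

/-- A nonzero coordinate of `B` is carried into `α` by translating along its dual vector, the swap
brings `β` or `A` into reach, and the square of the swap is `-1`, which corrects the sign. -/
theorem exists_pos_α {x : FMod c ℤ} (hx : x ≠ 0) : ∃ y, Equivalent x y ∧ 0 < y.α := by
  have h1 (x : FMod c ℤ) (h : x.α ≠ 0) : ∃ y, Equivalent x y ∧ 0 < y.α := by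
    rcases lt_or_gt_of_ne h with h | h
    · exact ⟨-x, equivalent_neg x, by simpa using h⟩
    · exact ⟨x, .refl x, h⟩
  have h2 (x : FMod c ℤ) (h : x.B ≠ 0) : ∃ y, Equivalent x y ∧ 0 < y.α := by
    by_cases hα : x.α = 0
    · obtain ⟨p, hp⟩ := Function.ne_iff.1 h
      obtain ⟨q, l, hql⟩ := dualSingle_eq_single (R := ℤ) p 1
      obtain ⟨y, hy, hy'⟩ := h1 (FMod.mk (x.α + tr x.B (Pi.single q l)) x.β
        (x.A + x.β • Pi.single q l) (x.B + cross x.A (Pi.single q l)))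
        (by simpa [← hql, hα, tr_dualSingle] using hp)
      exact ⟨y, (equivalent_trans x q l).trans hy, hy'⟩
    · exact h1 x hα
  by_cases hα : x.α = 0
  · by_cases hB : x.B = 0
    · by_cases hβ : x.β = 0
      · obtain ⟨y, hy, hy'⟩ := h2 (FMod.mk (-x.β) x.α (-x.B) x.A) (by
          simp only [FMod.B_mk]
          intro hA
          exact hx (FMod.ext' hα hβ hA hB))
        exact ⟨y, (equivalent_swap x).trans hy, hy'⟩
      · obtain ⟨y, hy, hy'⟩ := h1 (FMod.mk (-x.β) x.α (-x.B) x.A) (by simpa using hβ)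
        exact ⟨y, (equivalent_swap x).trans hy, hy'⟩
    · exact h2 x hB
  · exact h1 x hα

/-- `m` is the least positive value of the coordinate `α` on the class of `x`. -/
def IsMinimalα (x : FMod c ℤ) (m : ℤ) : Prop :=
  0 < m ∧ (∃ y, Equivalent x y ∧ y.α = m) ∧ ∀ y, Equivalent x y → 0 < y.α → m ≤ y.α

theorem exists_isMinimalα {x : FMod c ℤ} (hx : x ≠ 0) : ∃ m, IsMinimalα x m := by
  classical
  have h : ∃ n : ℕ, 0 < n ∧ ∃ y, Equivalent x y ∧ y.α = n := by
    obtain ⟨y, hy, hy'⟩ := exists_pos_α hx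
    exact ⟨y.α.toNat, by omega, y, hy, by omega⟩
  obtain ⟨h1, h2⟩ := Nat.find_spec h
  refine ⟨Nat.find h, by exact_mod_cast h1, h2, fun y hy hy' => ?_⟩
  have := Nat.find_min' h (m := y.α.toNat) ⟨by omega, y, hy, by omega⟩
  omega

namespace IsMinimalα

variable {x y : FMod c ℤ} {m : ℤ}

/-- Otherwise an opposite translation replaces `B p` by its nonzero remainder modulo `m`, and a
translation along the dual vector then lowers `α` to `m` minus that remainder, still positive. -/
theorem dvd_B (hm : IsMinimalα x m) (hy : Equivalent x y) (hα : y.α = m) (p : HermIdx c) :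
    m ∣ y.B p := by
  by_contra h
  obtain ⟨hm0, -, hmin⟩ := hm
  have h1 := Int.emod_nonneg (y.B p) hm0.ne'
  have h2 := Int.emod_lt_of_pos (y.B p) hm0
  have h3 : y.B p % m ≠ 0 := fun h3 => h (Int.dvd_of_emod_eq_zero h3)
  obtain ⟨q, l, hql⟩ := dualSingle_eq_single (R := ℤ) p (-1)
  have h4 := hmin _ ((hy.trans (equivalent_dual y p (-(y.B p / m)))).trans
    (equivalent_trans _ q l))
  rw [← hql, tr_dualSingle] at h4
  have h5 := Int.emod_add_mul_ediv (y.B p) m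
  simp only [FMod.α_mk, FMod.B_mk, hα, Pi.add_apply, Pi.smul_apply, Pi.single_eq_same,
    smul_eq_mul] at h4
  have h6 : m + -1 * (y.B p + m * -(y.B p / m)) = m - y.B p % m := by linarith
  rw [h6] at h4
  have := h4 (by omega)
  omega

/-- Coordinates of `B` are cleared one at a time. Each step changes `A` by a cross product with `B`,
which is divisible by `m`; this congruence is what `dvd_β` uses. -/
theorem exists_B_eq_zero (hm : IsMinimalα x m) (hy : Equivalent x y) (hα : y.α = m) :
    ∃ z, Equivalent x z ∧ z.α = m ∧ z.B = 0 ∧ ∀ p, m ∣ z.A p - y.A p := by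
  classical
  suffices h : ∀ s : Finset (HermIdx c), ∃ z, Equivalent x z ∧ z.α = m ∧
      (∀ p, m ∣ z.A p - y.A p) ∧ ∀ p ∈ s, z.B p = 0 by
    obtain ⟨z, h1, h2, h3, h4⟩ := h Finset.univ
    exact ⟨z, h1, h2, funext fun p => h4 p (Finset.mem_univ p), h3⟩
  intro s
  induction s using Finset.induction_on with
  | empty => exact ⟨y, hy, hα, by simp, by simp⟩
  | insert p s hp ih =>
    obtain ⟨z, h1, h2, h3, h4⟩ := ih
    choose W hW using hm.dvd_B h1 h2
    have hW' : z.B = m • (W : Herm c ℤ) := funext hW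
    refine ⟨_, h1.trans (equivalent_dual z p (-W p)), by simpa using h2, fun q => ?_,
      fun q hq => ?_⟩
    · rw [FMod.A_mk, hW', cross_smul_left, Pi.add_apply, add_sub_right_comm]
      exact (h3 q).add (Dvd.intro _ rfl)
    · simp only [FMod.B_mk, Pi.add_apply, Pi.smul_apply, smul_eq_mul, h2]
      rcases Finset.mem_insert.1 hq with rfl | hq
      · rw [hW, Pi.single_eq_same]
        ring
      · rw [h4 q hq, Pi.single_eq_of_ne (fun h => hp (by rwa [← h]))]
        ring

theorem dvd_A (hm : IsMinimalα x m) (hy : Equivalent x y) (hα : y.α = m) (hB : y.B = 0)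
    (p : HermIdx c) : m ∣ y.A p := by
  -- As `B = 0`, translating along the `i`-th diagonal unit keeps `α = m` and turns `B` into its
  -- cross product with `A`, so `dvd_B` applies. Up to sign, these products contain every entry of
  -- `A`.
  have key (i : Fin 3) (q : HermIdx c) : m ∣ cross y.A (Pi.single (Sum.inl i) 1) q := by
    have h := hm.dvd_B (hy.trans (equivalent_trans y (Sum.inl i) 1))
      (by simp [hα, hB, tr_zero_left]) q
    simpa [hB] using h
  rcases p with i | ⟨i, t⟩
  · have h : y.A.d i = (cross y.A (Pi.single (Sum.inl (i + 1)) 1)).d (i + 2) := by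
      fin_cases i <;> simp [d_single_inl, o_single_inl, compPolar_zero_right]
    exact (congrArg (m ∣ ·) h).mpr (key (i + 1) (Sum.inl (i + 2)))
  · have h : -y.A.o i = (cross y.A (Pi.single (Sum.inl i) 1)).o i := by
      simp [d_single_inl, o_single_inl, compMul_zero_right, compMul_zero_left, compConj_zero]
    have h' := key i (Sum.inr (i, t))
    change m ∣ (cross y.A (Pi.single (Sum.inl i) 1)).o i t at h'
    rw [← h] at h'
    exact (dvd_neg (a := m)).1 h'

/-- Translating along a diagonal unit adds `β` to an entry of `A`. Clearing `B` again changes that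
entry only modulo `m`, and `dvd_A` holds before and after. -/
theorem dvd_β (hm : IsMinimalα x m) (hy : Equivalent x y) (hα : y.α = m) (hB : y.B = 0) :
    m ∣ y.β := by
  have h1 := hy.trans (equivalent_trans y (Sum.inl 0) 1)
  obtain ⟨z, h2, h3, h4, h5⟩ := hm.exists_B_eq_zero h1 (by simp [hα, hB, tr_zero_left])
  have h6 := h5 (Sum.inl 0)
  rw [dvd_sub_right (hm.dvd_A h2 h3 h4 _), FMod.A_mk, Pi.add_apply,
    dvd_add_right (hm.dvd_A hy hα hB _)] at h6
  simpa using h6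

end IsMinimalα

end Orbits

/-! ### Diagonalization of Hermitian matrices by transvections. -/

section Diagonalization

variable {c : Coeff}

/-- `A` and `A'` are related by transformations of the Jordan algebra that come from the
elementary group. -/
def JEquivalent (A A' : Herm c ℤ) : Prop :=
  ∀ α β : ℤ, Equivalent (FMod.mk α β A 0) (FMod.mk α β A' 0)

theorem JEquivalent.refl (A : Herm c ℤ) : JEquivalent A A := fun _ _ => .refl _

theorem JEquivalent.trans {A B C : Herm c ℤ} (h₁ : JEquivalent A B) (h₂ : JEquivalent B C) :
    JEquivalent A C := fun α β => (h₁ α β).trans (h₂ α β)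

/-- The commutator of an opposite translation along `D` and a translation along `C`. Orthogonality
`h₁` restores `α` and `β`, and `h₂` is exactly the vanishing of the final `B`. -/
theorem jEquivalent_commutator (A : Herm c ℤ) (p q : HermIdx c) (k l : ℤ)
    (h₁ : tr (Pi.single p k : Herm c ℤ) (Pi.single q l) = 0)
    (h₂ : cross (cross (cross A (Pi.single p k)) (Pi.single q l)) (Pi.single p k) = 0) :
    JEquivalent A (A + tr A (Pi.single q l) • Pi.single p k
      - cross (cross A (Pi.single p k)) (Pi.single q l)) := by
  intro α β
  have e₁ := equivalent_dual (FMod.mk α β A 0) q l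
  have e₂ := e₁.trans (equivalent_trans _ p k)
  have e₃ := e₂.trans (equivalent_dual _ q (-l))
  have e₄ := e₃.trans (equivalent_trans _ p (-k))
  have hC := sharp_single (R := ℤ) p k
  have hD := sharp_single (R := ℤ) q l
  have h₁' : tr (Pi.single q l : Herm c ℤ) (Pi.single p k) = 0 := by rw [tr_comm, h₁]
  convert e₄ using 1
  simp only [Pi.single_neg] at *
  generalize (Pi.single p k : Herm c ℤ) = C at *
  generalize (Pi.single q l : Herm c ℤ) = D at *
  apply FMod.ext'
  · simp only [FMod.α_mk, FMod.β_mk, FMod.A_mk, FMod.B_mk, tr_add_left, tr_smul_left,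
      tr_neg_right, tr_zero_left, cross_zero_left, cross_neg_right, smul_neg,
      tr_neg_left, h₁', tr_cross_self_right hC, cross_add_left, cross_smul_left]
    ring
  · simp only [FMod.α_mk, FMod.β_mk, FMod.A_mk, FMod.B_mk, tr_add_left, tr_smul_left,
      tr_neg_right, tr_zero_left, cross_zero_left, h₁, add_zero, mul_zero]
    ring
  · simp only [FMod.α_mk, FMod.β_mk, FMod.A_mk, FMod.B_mk, tr_add_left, tr_smul_left,
      tr_neg_right, tr_zero_left, cross_zero_left, cross_neg_right, h₁, h₁', cross_add_left,
      cross_smul_left, cross_self_eq_zero hD, add_zero, mul_zero]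
    module
  · simp only [FMod.α_mk, FMod.β_mk, FMod.A_mk, FMod.B_mk, tr_add_left, tr_smul_left,
      tr_neg_right, tr_zero_left, cross_zero_left, cross_neg_right, cross_neg_left, h₁, h₁',
      cross_add_left, cross_smul_left, cross_self_eq_zero hC, cross_self_eq_zero hD, h₂,
      add_zero, mul_zero]
    module

/-- A transvection: `i`, `s`, `r` are the three indices. -/
theorem exists_transvection (i s r : Fin 3) (his : i ≠ s) (hsr : s ≠ r) (hir : i ≠ r)
    (A : Herm c ℤ) (t : Fin c.dim) (k : ℤ) :
    ∃ A', JEquivalent A A' ∧ A'.d i = A.d i + compPolar c (A.o s) (Pi.single t k) ∧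
      A'.d s = A.d s ∧ A'.d r = A.d r ∧ A'.o i = A.o i ∧
      A'.o s = A.o s + A.d r • Pi.single t k ∧ (A.o i = 0 → A'.o r = A.o r) := by
  -- Take `C` the `i`-th diagonal unit and `D` supported at the entry in rows `i` and `r`: a
  -- multiple of row `r` is added to row `i`. The term `n(D) d r` expected in `d i` is zero, as
  -- coordinate vectors are isotropic.
  refine ⟨_, jEquivalent_commutator A (Sum.inl i) (Sum.inr (s, t)) 1 k ?_ ?_, ?_, ?_, ?_, ?_,
    ?_, ?_⟩
  · simp [tr_eq, d_single_inl, o_single_inl, d_single_inr, o_single_inr, compPolar_zero_left]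
  · apply ext' <;> intro j
    all_goals
      fin_cases i <;> fin_cases s <;> fin_cases r <;> simp at his hsr hir <;> fin_cases j <;>
        simp [d_single_inl, o_single_inl, d_single_inr, o_single_inr, compPolar_zero_left,
          compPolar_zero_right, compMul_zero_left, compMul_zero_right, compConj_zero]
  all_goals
    fin_cases i <;> fin_cases s <;> fin_cases r <;> simp at his hsr hir <;>
      simp +contextual [tr_eq, d_single_inl, o_single_inl, d_single_inr, o_single_inr,
        compPolar_zero_left, compPolar_zero_right, compMul_zero_left, compMul_zero_right,
        compConj_zero, -zsmul_eq_mul]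

/-- If a diagonal entry does not divide an entry in its row, then a transvection makes it
smaller. -/
theorem exists_smaller_pivot (i s r : Fin 3) (his : i ≠ s) (hsr : s ≠ r) (hir : i ≠ r)
    (A : Herm c ℤ) (t : Fin c.dim) (h0 : A.d r ≠ 0) (h : ¬ A.d r ∣ A.o s t) :
    ∃ A', JEquivalent A A' ∧ A'.d r ≠ 0 ∧ (A'.d r).natAbs < (A.d r).natAbs ∧
      (A.o r = 0 → A.o i = 0 → A'.o r = 0 ∧ A'.o i = 0) := by
  obtain ⟨B, hB, -, -, hr, hi, hs, hr'⟩ :=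
    exists_transvection i s r his hsr hir A t (-(A.o s t / A.d r))
  have e : B.o s t = A.o s t % A.d r := by
    rw [hs, Int.emod_def, Pi.add_apply, Pi.smul_apply, Pi.single_eq_same, smul_eq_mul]
    ring
  -- The entry is now its remainder modulo the pivot. Adding row `i` to row `r` along the dual
  -- coordinate subtracts this remainder from the pivot's absolute value, leaving it smaller but
  -- nonzero.
  obtain ⟨A', hA', hr2, -, -, hr3, -, hi2⟩ := exists_transvection r s i hsr.symm his.symm hir.symm
    B (compFlip c t) (compSign c t * -(A.d r).sign)
  have e2 : A'.d r = A.d r - (A.d r).sign * (A.o s t % A.d r) := by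
    have := compPolar_single c (B.o s) t (-(A.d r).sign)
    simp only [Int.cast_id] at this
    rw [hr2, this, e, hr]
    ring
  have h1 := Int.emod_nonneg (A.o s t) h0
  have h2 := Int.emod_lt_abs (A.o s t) h0
  have h3 : A.o s t % A.d r ≠ 0 := fun h3 => h (Int.dvd_of_emod_eq_zero h3)
  refine ⟨A', hB.trans hA', ?_, ?_, fun hAr hAi => ⟨?_, ?_⟩⟩
  · rcases lt_or_gt_of_ne h0 with h4 | h4
    · rw [e2, Int.sign_eq_neg_one_of_neg h4]
      rw [abs_of_neg h4] at h2
      omega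
    · rw [e2, Int.sign_eq_one_of_pos h4]
      rw [abs_of_pos h4] at h2
      omega
  · rcases lt_or_gt_of_ne h0 with h4 | h4
    · rw [e2, Int.sign_eq_neg_one_of_neg h4]
      rw [abs_of_neg h4] at h2
      omega
    · rw [e2, Int.sign_eq_one_of_pos h4]
      rw [abs_of_pos h4] at h2
      omega
  · rw [hr3, hr' hAi, hAr]
  · rw [hi2 (by rw [hr' hAi, hAr]), hi, hAi]

/-- If a diagonal entry divides an off-diagonal entry in its row, the latter can be cleared. -/
theorem exists_clear (i s r : Fin 3) (his : i ≠ s) (hsr : s ≠ r) (hir : i ≠ r)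
    (A : Herm c ℤ) (h : ∀ t, A.d r ∣ A.o s t) :
    ∃ A', JEquivalent A A' ∧ A'.d r = A.d r ∧ A'.o s = 0 ∧ A'.o i = A.o i ∧
      (A.o i = 0 → A'.o r = A.o r) := by
  classical
  suffices h : ∀ T : Finset (Fin c.dim), ∃ A', JEquivalent A A' ∧ A'.d r = A.d r ∧
      A'.o i = A.o i ∧ (A.o i = 0 → A'.o r = A.o r) ∧ (∀ t, A.d r ∣ A'.o s t) ∧
      ∀ t ∈ T, A'.o s t = 0 by
    obtain ⟨A', h1, h2, h3, h4, -, h5⟩ := h Finset.univ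
    exact ⟨A', h1, h2, funext fun t => h5 t (Finset.mem_univ t), h3, h4⟩
  intro T
  induction T using Finset.induction_on with
  | empty => exact ⟨A, .refl A, rfl, rfl, fun _ => rfl, h, by simp⟩
  | insert t T ht ih =>
    obtain ⟨B, h1, h2, h3, h4, h5, h6⟩ := ih
    obtain ⟨k, hk⟩ := h5 t
    obtain ⟨A', hA', -, -, g1, g2, g3, g4⟩ := exists_transvection i s r his hsr hir B t (-k)
    have e (u : Fin c.dim) : A'.o s u = B.o s u + A.d r * (Pi.single t (-k) : Fin c.dim → ℤ) u := by
      rw [g3, h2]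
      rfl
    refine ⟨A', h1.trans hA', g1.trans h2, g2.trans h3, fun h => ?_, fun u => ?_, fun u hu => ?_⟩
    · rw [g4 (h3.trans h), h4 h]
    · rw [e]
      exact (h5 u).add (Dvd.intro _ rfl)
    · rw [e]
      rcases Finset.mem_insert.1 hu with rfl | hu
      · rw [hk, Pi.single_eq_same]
        ring
      · rw [h6 u hu, Pi.single_eq_of_ne (fun h => ht (by rwa [← h]))]
        ring

theorem exists_third {r s : Fin 3} (h : s ≠ r) : ∃ i, i ≠ s ∧ i ≠ r := by
  revert r s
  decide

theorem eq_of_third {i s r : Fin 3} (his : i ≠ s) (hsr : s ≠ r) (hir : i ≠ r) (j : Fin 3) :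
    j = i ∨ j = s ∨ j = r := by
  revert i s r j
  decide

/-- Induction on the size of the pivot: either some entry of its row is not divisible by it and the
pivot shrinks, or both entries of the row can be cleared, leaving a 1×1 and a 2×2 block. -/
theorem exists_split_of_pivot (n : ℕ) (A : Herm c ℤ) (r : Fin 3) (h0 : A.d r ≠ 0)
    (hn : (A.d r).natAbs = n) : ∃ A', JEquivalent A A' ∧ ∀ j, j ≠ r → A'.o j = 0 := by
  induction n using Nat.strong_induction_on generalizing A with
  | _ n ih =>
    have step (B : Herm c ℤ) (hAB : JEquivalent A B) (hr : B.d r = A.d r) (s : Fin 3)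
        (hs : s ≠ r) (t : Fin c.dim) (h : ¬ B.d r ∣ B.o s t) :
        ∃ A', JEquivalent A A' ∧ ∀ j, j ≠ r → A'.o j = 0 := by
      obtain ⟨i, his, hir⟩ := exists_third hs
      obtain ⟨C, h1, h2, h3, -⟩ := exists_smaller_pivot i s r his hs hir B t (by rwa [hr]) h
      rw [hr, hn] at h3
      obtain ⟨A', h4, h5⟩ := ih _ h3 C h2 rfl
      exact ⟨A', (hAB.trans h1).trans h4, h5⟩
    by_contra hcon
    have dvd (B : Herm c ℤ) (hAB : JEquivalent A B) (hr : B.d r = A.d r) (s : Fin 3)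
        (hs : s ≠ r) (t : Fin c.dim) : B.d r ∣ B.o s t :=
      not_not.1 fun h => hcon (step B hAB hr s hs t h)
    obtain ⟨s, hs⟩ := exists_ne r
    obtain ⟨i, his, hir⟩ := exists_third hs
    obtain ⟨B, h1, h2, h3, -, -⟩ := exists_clear i s r his hs hir A (dvd A (.refl A) rfl s hs)
    obtain ⟨C, h4, h5, h6, h7, -⟩ := exists_clear s i r his.symm hir hs B (dvd B h1 h2 i hir)
    refine hcon ⟨C, h1.trans h4, fun j hj => ?_⟩
    rcases eq_of_third his hs hir j with rfl | rfl | rfl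
    · exact h6
    · rw [h7, h3]
    · exact absurd rfl hj

theorem exists_split (A : Herm c ℤ) :
    ∃ A', JEquivalent A A' ∧ ∃ r, ∀ j, j ≠ r → A'.o j = 0 := by
  by_cases hd : ∃ r, A.d r ≠ 0
  · obtain ⟨r, hr⟩ := hd
    obtain ⟨A', h1, h2⟩ := exists_split_of_pivot _ A r hr rfl
    exact ⟨A', h1, r, h2⟩
  · push Not at hd
    by_cases ho : ∃ s t, A.o s t ≠ 0
    · obtain ⟨s, t, hst⟩ := ho
      obtain ⟨r, hr⟩ := exists_ne s
      obtain ⟨i, hi, hi'⟩ := exists_third hr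
      -- With zero diagonal, a transvection along the dual coordinate copies a nonzero off-diagonal
      -- coordinate to the diagonal, creating a pivot.
      obtain ⟨B, h1, h2, -⟩ := exists_transvection r s i hr hi'.symm hi.symm A (compFlip c t)
        (compSign c t * 1)
      have := compPolar_single c (A.o s) t 1
      simp only [Int.cast_id] at this
      rw [this, hd, zero_add, one_mul] at h2
      obtain ⟨A', h3, h4⟩ := exists_split_of_pivot _ B r (by rwa [h2]) rfl
      exact ⟨A', h1.trans h3, r, h4⟩
    · push Not at ho
      exact ⟨A, .refl A, 0, fun j _ => funext (ho j)⟩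

/-- The same descent inside the remaining 2×2 block; the vanishing of the entries `i` and `r` must
survive each step. -/
theorem exists_diagonal_of_pivot (n : ℕ) (A : Herm c ℤ) (i s r : Fin 3) (his : i ≠ s)
    (hsr : s ≠ r) (hir : i ≠ r) (hr : A.o r = 0) (hi : A.o i = 0) (h0 : A.d r ≠ 0)
    (hn : (A.d r).natAbs = n) : ∃ A', JEquivalent A A' ∧ ∀ j, A'.o j = 0 := by
  induction n using Nat.strong_induction_on generalizing A with
  | _ n ih =>
    by_cases h : ∀ t, A.d r ∣ A.o s t
    · obtain ⟨B, h1, -, h2, h3, h4⟩ := exists_clear i s r his hsr hir A h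
      refine ⟨B, h1, fun j => ?_⟩
      rcases eq_of_third his hsr hir j with rfl | rfl | rfl
      · rw [h3, hi]
      · exact h2
      · rw [h4 hi, hr]
    · push Not at h
      obtain ⟨t, ht⟩ := h
      obtain ⟨C, h1, h2, h3, h4⟩ := exists_smaller_pivot i s r his hsr hir A t h0 ht
      obtain ⟨A', h5, h6⟩ := ih _ (hn ▸ h3) C (h4 hr hi).1 (h4 hr hi).2 h2 rfl
      exact ⟨A', h1.trans h5, h6⟩

/-- Every Hermitian matrix over a split composition ring can be diagonalized. -/
theorem exists_diagonal (A : Herm c ℤ) : ∃ a, JEquivalent A (Herm.diag c a) := by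
  suffices h : ∃ A', JEquivalent A A' ∧ ∀ j, A'.o j = 0 by
    obtain ⟨A', h1, h2⟩ := h
    refine ⟨A'.d, ?_⟩
    convert h1 using 1
    exact ext' (fun _ => rfl) fun j => (h2 j).symm
  obtain ⟨B, hB, s, hs⟩ := exists_split A
  suffices h : ∃ A', JEquivalent B A' ∧ ∀ j, A'.o j = 0 by
    obtain ⟨A', h1, h2⟩ := h
    exact ⟨A', hB.trans h1, h2⟩
  by_cases hd : ∃ r, r ≠ s ∧ B.d r ≠ 0
  · obtain ⟨r, hr, h0⟩ := hd
    obtain ⟨i, hir, his⟩ := exists_third hr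
    exact exists_diagonal_of_pivot _ B i s r his hr.symm hir (hs r hr) (hs i his) h0 rfl
  · push Not at hd
    by_cases ho : ∃ t, B.o s t ≠ 0
    · obtain ⟨t, ht⟩ := ho
      obtain ⟨r, hr⟩ := exists_ne s
      obtain ⟨i, hir, his⟩ := exists_third hr
      obtain ⟨C, h1, h2, -, -, h3, -, h4⟩ := exists_transvection r s i hr his.symm hir.symm B
        (compFlip c t) (compSign c t * 1)
      have := compPolar_single c (B.o s) t 1
      simp only [Int.cast_id] at this
      rw [this, hd r hr, zero_add, one_mul] at h2
      obtain ⟨A', h5, h6⟩ := exists_diagonal_of_pivot _ C i s r his hr.symm hir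
        (by rw [h3, hs r hr]) (by rw [h4 (hs r hr), hs i his]) (by rwa [h2]) rfl
      exact ⟨A', h1.trans h5, h6⟩
    · push Not at ho
      refine ⟨B, .refl B, fun j => ?_⟩
      by_cases hj : j = s
      · rw [hj]
        exact funext ho
      · exact hs j hj

/-- Every nonzero element is equivalent to a diagonal reduced element. -/
theorem exists_diagonal_reduced {x : FMod c ℤ} (hx : x ≠ 0) :
    ∃ (α β : ℤ) (a : Fin 3 → ℤ), 0 < α ∧ α ∣ β ∧ (∀ i, α ∣ a i) ∧
      Equivalent x (FMod.mk α β (Herm.diag c a) 0) := by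
  obtain ⟨m, hm⟩ := exists_isMinimalα hx
  obtain ⟨y, hy, hα⟩ := hm.2.1
  obtain ⟨z, h1, h2, h3, -⟩ := hm.exists_B_eq_zero hy hα
  obtain ⟨a, ha⟩ := exists_diagonal z.A
  have h4 : Equivalent x (FMod.mk m z.β (Herm.diag c a) 0) := by
    refine h1.trans ?_
    convert ha m z.β using 1
    exact FMod.ext' h2 rfl rfl h3
  -- Diagonalizing keeps `α = m` and `B = 0`, so the divisibilities hold again for the diagonal
  -- element itself.
  exact ⟨m, z.β, a, hm.1, by simpa using hm.dvd_β h4 rfl rfl, fun i => hm.dvd_A h4 rfl rfl (Sum.inl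
      i), h4⟩

end Diagonalization

/-! ### Compatibility with ring homomorphisms; the half derivative of `q'`. -/

section Composites

variable {R S : Type*}

theorem bin_comp_apply (f : R → S) (x : Comp .bin R) (i : Fin 2) :
    (f ∘ x : Comp .bin S) i = f (x i) := rfl

theorem quat_comp_apply (f : R → S) (x : Comp .quat R) (i : Fin 4) :
    (f ∘ x : Comp .quat S) i = f (x i) := rfl

theorem oct_comp_apply (f : R → S) (x : Comp .oct R) (i : Fin 8) :
    (f ∘ x : Comp .oct S) i = f (x i) := rfl

end Composites

section Naturality

variable {c : Coeff} {R S : Type*} [CommRing R] [CommRing S] (f : R →+* S)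

theorem compMul_map (c : Coeff) (x y : Comp c R) :
    compMul c (f ∘ x) (f ∘ y) = f ∘ compMul c x y := by
  cases c
  · exact Subsingleton.elim (α := Fin 0 → S) _ _
  · apply bin_ext <;> simp only [bin_comp_apply] <;> simp [bin_comp_apply, compMul]
  · apply quat_ext <;> simp only [quat_comp_apply] <;> simp [quat_comp_apply, compMul, quatMul]
  · apply oct_ext <;> simp only [oct_comp_apply] <;> simp [oct_comp_apply, compMul, quatMul, octMk,
        octFst, octSnd, quatConj]

theorem compConj_map (c : Coeff) (x : Comp c R) : compConj c (f ∘ x) = f ∘ compConj c x := by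
  cases c
  · exact Subsingleton.elim (α := Fin 0 → S) _ _
  · apply bin_ext <;> simp only [bin_comp_apply] <;> simp [bin_comp_apply, compConj]
  · apply quat_ext <;> simp only [quat_comp_apply] <;> simp [quat_comp_apply, compConj, quatConj]
  · apply oct_ext <;> simp only [oct_comp_apply] <;> simp [oct_comp_apply, compConj, octMk, octFst,
        octSnd, quatConj]

theorem compTrace_map (c : Coeff) (x : Comp c R) : compTrace c (f ∘ x) = f (compTrace c x) := by
  cases c <;> simp [bin_comp_apply, quat_comp_apply, oct_comp_apply, compTrace]

theorem compNorm_map (c : Coeff) (x : Comp c R) : compNorm c (f ∘ x) = f (compNorm c x) := by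
  cases c <;> simp [bin_comp_apply, quat_comp_apply, oct_comp_apply, compNorm, quatNorm, octFst,
      octSnd]

theorem compPolar_map (c : Coeff) (x y : Comp c R) :
    compPolar c (f ∘ x) (f ∘ y) = f (compPolar c x y) := by
  simp only [compPolar, compConj_map, compMul_map, compTrace_map]

namespace Herm

theorem d_map (A : Herm c R) (i : Fin 3) : Herm.d (f ∘ A) i = f (A.d i) := rfl

theorem o_map (A : Herm c R) (i : Fin 3) : Herm.o (f ∘ A) i = f ∘ A.o i := rfl

theorem tr_map (A B : Herm c R) : tr (f ∘ A) (f ∘ B) = f (tr A B) := by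
  simp only [tr_eq, d_map, o_map, compPolar_map, map_add, map_mul]

theorem norm_map (A : Herm c R) : Herm.norm (f ∘ A) = f A.norm := by
  simp only [norm_eq, d_map, o_map, compNorm_map, compMul_map, compTrace_map, map_add, map_sub,
    map_mul]

theorem sharp_map (A : Herm c R) : sharp (f ∘ A) = f ∘ sharp A := by
  refine ext' (fun i => ?_) fun i => ?_
  · simp only [d_sharp, d_map, o_map, compNorm_map, map_sub, map_mul]
  · simp only [o_sharp, d_map, o_map, compMul_map, compConj_map]
    funext j
    simp

theorem cross_map (A B : Herm c R) : cross (f ∘ A) (f ∘ B) = f ∘ cross A B := by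
  refine ext' (fun i => ?_) fun i => ?_
  · simp only [d_cross, d_map, o_map, compPolar_map, map_sub, map_mul, map_add]
  · simp only [o_cross, d_map, o_map, compMul_map, compConj_map]
    funext j
    simp

end Herm

theorem FMod.α_map (x : FMod c R) : FMod.α (f ∘ x) = f x.α := rfl
theorem FMod.β_map (x : FMod c R) : FMod.β (f ∘ x) = f x.β := rfl
theorem FMod.A_map (x : FMod c R) : FMod.A (f ∘ x) = f ∘ x.A := rfl
theorem FMod.B_map (x : FMod c R) : FMod.B (f ∘ x) = f ∘ x.B := rfl

theorem quartic_map (x : FMod c R) : quartic (f ∘ x) = f (quartic x) := by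
  simp only [quartic, quartic', FMod.α_map, FMod.β_map, FMod.A_map, FMod.B_map, sharp_map, tr_map,
    Herm.norm_map, map_add, map_sub, map_mul, map_neg, map_pow, map_ofNat]

theorem symp_map (x y : FMod c R) : symp (f ∘ x) (f ∘ y) = f (symp x y) := by
  simp only [symp, FMod.α_map, FMod.β_map, FMod.A_map, FMod.B_map, tr_map, map_add, map_sub,
    map_mul]

/-- Half the derivative of `q'` at `x` in the direction `w`. -/
def halfDeriv (x w : FMod c R) : R :=
  -2 * tr (cross x.A w.A) x.B.sharp - 2 * tr x.A.sharp (cross x.B w.B)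
    + 2 * w.α * x.A.norm + 2 * x.α * tr x.A.sharp w.A
    + 2 * w.β * x.B.norm + 2 * x.β * tr x.B.sharp w.B
    + (tr x.A x.B - x.α * x.β) * (tr w.A x.B + tr x.A w.B - w.α * x.β - x.α * w.β)

theorem halfDeriv_map (x w : FMod c R) : halfDeriv (f ∘ x) (f ∘ w) = f (halfDeriv x w) := by
  simp only [halfDeriv, FMod.α_map, FMod.β_map, FMod.A_map, FMod.B_map, sharp_map, cross_map,
    tr_map, Herm.norm_map, map_add, map_sub, map_mul, map_neg, map_ofNat]

theorem halfDeriv_add_right (x v w : FMod c R) :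
    halfDeriv x (v + w) = halfDeriv x v + halfDeriv x w := by
  simp only [halfDeriv, FMod.α_add, FMod.β_add, FMod.A_add, FMod.B_add, tr_add_left, tr_add_right,
    cross_add_right]
  ring

theorem halfDeriv_smul_right (k : R) (x w : FMod c R) :
    halfDeriv x (k • w) = k * halfDeriv x w := by
  simp only [halfDeriv, FMod.α_smul, FMod.β_smul, FMod.A_smul, FMod.B_smul, tr_smul_left,
    tr_smul_right, cross_smul_right]
  ring

end Naturality

/-! ### The formal gradient of `q'` and its evenness. -/

section Derivative

variable {c : Coeff} {k P : Type*} [CommRing k] [CommRing P] [Algebra k P]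
  (D : Derivation k P P)

theorem derivation_compNorm (c : Coeff) (x : Comp c P) :
    D (compNorm c x) = compPolar c x (D ∘ x) := by
  cases c <;> simp [bin_comp_apply, quat_comp_apply, oct_comp_apply, compNorm, compPolar, compTrace,
      compMul, compConj, quatMul, quatConj, quatNorm,
    octMk, octFst, octSnd] <;> ring

theorem derivation_compPolar (c : Coeff) (x y : Comp c P) :
    D (compPolar c x y) = compPolar c (D ∘ x) y + compPolar c x (D ∘ y) := by
  cases c <;> simp [bin_comp_apply, quat_comp_apply, oct_comp_apply, compPolar, compTrace, compMul,
      compConj, quatMul, quatConj, octMk, octFst, octSnd] <;> ring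

theorem derivation_compTrace (c : Coeff) (x : Comp c P) :
    D (compTrace c x) = compTrace c (D ∘ x) := by
  cases c <;> simp [bin_comp_apply, quat_comp_apply, oct_comp_apply, compTrace]

theorem derivation_compMul (c : Coeff) (x y : Comp c P) :
    D ∘ compMul c x y = compMul c x (D ∘ y) + compMul c (D ∘ x) y := by
  cases c
  · exact Subsingleton.elim (α := Fin 0 → P) _ _
  · apply bin_ext <;> simp only [bin_add_apply, bin_comp_apply] <;> simp [bin_comp_apply, compMul]
        <;> ring
  · apply quat_ext <;> simp only [quat_add_apply, quat_comp_apply] <;> simp [quat_comp_apply,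
        compMul, quatMul] <;> ring
  · apply oct_ext <;> simp only [oct_add_apply, oct_comp_apply] <;>
      simp [oct_comp_apply, compMul, quatMul, octMk, octFst, octSnd, quatConj] <;> ring

theorem derivation_compConj (c : Coeff) (x : Comp c P) :
    D ∘ compConj c x = compConj c (D ∘ x) := by
  cases c
  · exact Subsingleton.elim (α := Fin 0 → P) _ _
  · apply bin_ext <;> simp only [bin_comp_apply] <;> simp [bin_comp_apply, compConj]
  · apply quat_ext <;> simp only [quat_comp_apply] <;> simp [quat_comp_apply, compConj, quatConj]
  · apply oct_ext <;> simp only [oct_comp_apply] <;> simp [oct_comp_apply, compConj, octMk, octFst,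
        octSnd, quatConj]

theorem derivation_tr (A B : Herm c P) : D (tr A B) = tr (D ∘ A) B + tr A (D ∘ B) := by
  have hd (A : Herm c P) (i : Fin 3) : Herm.d (D ∘ A) i = D (A.d i) := rfl
  have ho (A : Herm c P) (i : Fin 3) : Herm.o (D ∘ A) i = D ∘ A.o i := rfl
  simp only [tr_eq, map_add, Derivation.leibniz, derivation_compPolar, hd, ho, smul_eq_mul]
  ring

theorem derivation_sharp (A : Herm c P) : D ∘ sharp A = cross A (D ∘ A) := by
  have hd (A : Herm c P) (i : Fin 3) : Herm.d (D ∘ A) i = D (A.d i) := rfl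
  have ho (A : Herm c P) (i : Fin 3) : Herm.o (D ∘ A) i = D ∘ A.o i := rfl
  refine ext' (fun i => ?_) fun i => ?_
  · simp only [hd, d_sharp, d_cross, map_sub, Derivation.leibniz, derivation_compNorm, ho,
      smul_eq_mul]
    ring
  · rw [ho, o_sharp, o_cross, ho, ho, ho, hd, ← compConj_add, ← derivation_compMul,
      ← derivation_compConj]
    funext j
    simp only [Function.comp_apply, Pi.sub_apply, Pi.smul_apply, map_sub, Derivation.leibniz,
      smul_eq_mul]
    ring

theorem derivation_norm (A : Herm c P) : D A.norm = tr (sharp A) (D ∘ A) := by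
  have hd (A : Herm c P) (i : Fin 3) : Herm.d (D ∘ A) i = D (A.d i) := rfl
  have ho (A : Herm c P) (i : Fin 3) : Herm.o (D ∘ A) i = D ∘ A.o i := rfl
  simp only [norm_eq, tr_eq, d_sharp, o_sharp, sub_eq_add_neg, ← neg_smul, compPolar_add_left,
    compPolar_smul_left, Fin.reduceAdd, Fin.isValue, zero_add, compPolar_conj_mul, map_add,
    map_neg, Derivation.leibniz, derivation_compNorm, derivation_compTrace, derivation_compMul,
    compMul_add_left, compTrace_add, ← ho, compTrace_mul_o_one, compTrace_mul_o_two, ← hd,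
    smul_eq_mul]
  ring

/-- Applied to the generic point and a partial derivative, this makes the factor 2 explicit over the
polynomial ring. -/
theorem derivation_quartic' (x : FMod c P) : D (quartic' x) = 2 * halfDeriv x (D ∘ x) := by
  have hα : FMod.α (D ∘ x) = D x.α := rfl
  have hβ : FMod.β (D ∘ x) = D x.β := rfl
  have hA : FMod.A (D ∘ x) = D ∘ x.A := rfl
  have hB : FMod.B (D ∘ x) = D ∘ x.B := rfl
  have h4 : D 4 = 0 := by simpa using D.map_natCast 4
  simp only [quartic', halfDeriv, hα, hβ, hA, hB, map_add, map_sub, map_neg, Derivation.leibniz,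
    Derivation.leibniz_pow, derivation_tr, derivation_sharp, derivation_norm, smul_eq_mul, h4,
    nsmul_eq_mul]
  push_cast
  ring

theorem pderiv_quarticPoly (i : FIdx c) :
    MvPolynomial.pderiv i (quarticPoly c) =
      2 * halfDeriv (fun j => MvPolynomial.X j : FMod c (MvPolynomial (FIdx c) ℤ))
        (Pi.single i 1) := by
  classical
  rw [quarticPoly, derivation_quartic']
  congr 2
  funext j
  simp [MvPolynomial.pderiv_X, Pi.single_apply, eq_comm]

theorem grad_eq (x : FMod c ℤ) (i : FIdx c) : grad x i = 2 * halfDeriv x (Pi.single i 1) := by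
  rw [grad, pderiv_quarticPoly, map_mul, ← halfDeriv_map, map_ofNat]
  congr 2
  · funext j
    simp
  · funext j
    by_cases h : j = i <;> simp [h]

theorem halfGrad_eq (x : FMod c ℤ) (i : FIdx c) : halfGrad x i = halfDeriv x (Pi.single i 1) := by
  rw [halfGrad, grad_eq, Int.mul_ediv_cancel_left _ two_ne_zero]

end Derivative

/-! ### The operator `T`, its integrality, and the invariant gcd. -/

section TripleProduct

variable {c : Coeff} {R : Type*} [CommRing R]

theorem symp_add_left (x y w : FMod c R) : symp (x + y) w = symp x w + symp y w := by
  simp only [symp, FMod.α_add, FMod.β_add, FMod.A_add, FMod.B_add, tr_add_left]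
  ring

theorem symp_smul_left (k : R) (x w : FMod c R) : symp (k • x) w = k * symp x w := by
  simp only [symp, FMod.α_smul, FMod.β_smul, FMod.A_smul, FMod.B_smul, tr_smul_left]
  ring

theorem symp_add_right (w x y : FMod c R) : symp w (x + y) = symp w x + symp w y := by
  simp only [symp, FMod.α_add, FMod.β_add, FMod.A_add, FMod.B_add, tr_add_right]
  ring

theorem symp_smul_right (k : R) (w x : FMod c R) : symp w (k • x) = k * symp w x := by
  simp only [symp, FMod.α_smul, FMod.β_smul, FMod.A_smul, FMod.B_smul, tr_smul_right]
  ring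

/-- The element of the dual basis for the skew-symmetric form. -/
def dualBasis (R : Type*) [CommRing R] : FIdx c → FMod c R
  | .inl i => FMod.mk (![0, -1] i) (![1, 0] i) 0 0
  | .inr (.inl p) => FMod.mk 0 0 0 (dualSingle p 1)
  | .inr (.inr p) => FMod.mk 0 0 (dualSingle p (-1)) 0

theorem symp_dualBasis (x : FMod c R) (i : FIdx c) : symp x (dualBasis R i) = x i := by
  rcases i with i | p | p
  · fin_cases i <;> simp [dualBasis, symp, tr_zero_right] <;> rfl
  · simp [dualBasis, symp, tr_zero_right, tr_dualSingle, FMod.A]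
  · simp [dualBasis, symp, tr_zero_right, tr_dualSingle, FMod.B]

theorem dualSingle_map {S : Type*} [CommRing S] (f : R →+* S) (p : HermIdx c) (k : R) :
    f ∘ dualSingle p k = dualSingle p (f k) := by
  rcases p with i | ⟨i, t⟩ <;> funext q <;>
    simp [dualSingle, Pi.single_apply, apply_ite f]

theorem dualBasis_map {S : Type*} [CommRing S] (f : R →+* S) (i : FIdx c) :
    f ∘ dualBasis R i = dualBasis S i := by
  rcases i with i | p | p
  · apply FMod.ext' <;> simp only [FMod.α_map, FMod.β_map, FMod.A_map, FMod.B_map] <;>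
      fin_cases i <;> simp [dualBasis]
  · apply FMod.ext' <;> simp only [FMod.α_map, FMod.β_map, FMod.A_map, FMod.B_map] <;>
      simp [dualBasis, dualSingle_map]
  · apply FMod.ext' <;> simp only [FMod.α_map, FMod.β_map, FMod.A_map, FMod.B_map] <;>
      simp [dualBasis, dualSingle_map]

/-- The dual basis shows the form to be nondegenerate; in finite dimension it therefore represents
every functional. -/
theorem exists_symp_eq (l : FMod c ℚ →ₗ[ℚ] ℚ) : ∃ t, ∀ w, symp t w = l w := by
  let F : FMod c ℚ →ₗ[ℚ] Module.Dual ℚ (FMod c ℚ) :=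
    LinearMap.mk₂ ℚ symp symp_add_left symp_smul_left symp_add_right symp_smul_right
  have hF : Function.Injective F := by
    refine (injective_iff_map_eq_zero F).2 fun x hx => funext fun i => ?_
    rw [← symp_dualBasis x i]
    exact LinearMap.congr_fun hx _
  have hd : Module.finrank ℚ (FMod c ℚ) = Module.finrank ℚ (Module.Dual ℚ (FMod c ℚ)) :=
    (Subspace.dual_finrank_eq).symm
  obtain ⟨t, ht⟩ := (LinearMap.injective_iff_surjective_of_finrank_eq_finrank hd).1 hF l
  exact ⟨t, fun w => LinearMap.congr_fun ht w⟩

/-- A four-linear form, not symmetric, whose value on the diagonal is the quartic form. -/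
def fourForm (x y z w : FMod c ℚ) : ℚ :=
  -2 * (-tr (cross x.A y.A) (cross z.B w.B) + 2 / 3 * (x.α * tr (cross y.A z.A) w.A)
    + 2 / 3 * (x.β * tr (cross y.B z.B) w.B)
    + (tr x.A y.B - x.α * y.β) * (tr z.A w.B - z.α * w.β))

/-- On the diagonal `A × A` is twice the adjoint and `tr (A × A) A = 6 N(A)`, which explains the
coefficients 1 and 2/3 where `q'` has 4. -/
theorem fourForm_self (x : FMod c ℚ) : fourForm x x x x = quartic x := by
  simp only [fourForm, quartic, quartic', Herm.cross_self, tr_smul_left, tr_smul_right,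
    tr_sharp_self]
  ring

theorem fourForm_add₁ (x x' y z w : FMod c ℚ) :
    fourForm (x + x') y z w = fourForm x y z w + fourForm x' y z w := by
  simp only [fourForm, FMod.α_add, FMod.β_add, FMod.A_add, tr_add_left, cross_add_left]
  ring

theorem fourForm_add₂ (x y y' z w : FMod c ℚ) :
    fourForm x (y + y') z w = fourForm x y z w + fourForm x y' z w := by
  simp only [fourForm, FMod.β_add, FMod.A_add, FMod.B_add, tr_add_left, tr_add_right,
    cross_add_left, cross_add_right]
  ring

theorem fourForm_add₃ (x y z z' w : FMod c ℚ) :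
    fourForm x y (z + z') w = fourForm x y z w + fourForm x y z' w := by
  simp only [fourForm, FMod.α_add, FMod.A_add, FMod.B_add, tr_add_left, tr_add_right,
    cross_add_left, cross_add_right]
  ring

theorem fourForm_add₄ (x y z w w' : FMod c ℚ) :
    fourForm x y z (w + w') = fourForm x y z w + fourForm x y z w' := by
  simp only [fourForm, FMod.β_add, FMod.A_add, FMod.B_add, tr_add_right,
    cross_add_right]
  ring

theorem fourForm_smul₁ (k : ℚ) (x y z w : FMod c ℚ) :
    fourForm (k • x) y z w = k * fourForm x y z w := by
  simp only [fourForm, FMod.α_smul, FMod.β_smul, FMod.A_smul, tr_smul_left,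
    cross_smul_left]
  ring

theorem fourForm_smul₂ (k : ℚ) (x y z w : FMod c ℚ) :
    fourForm x (k • y) z w = k * fourForm x y z w := by
  simp only [fourForm, FMod.β_smul, FMod.A_smul, FMod.B_smul, tr_smul_left,
    tr_smul_right, cross_smul_left, cross_smul_right]
  ring

theorem fourForm_smul₃ (k : ℚ) (x y z w : FMod c ℚ) :
    fourForm x y (k • z) w = k * fourForm x y z w := by
  simp only [fourForm, FMod.α_smul, FMod.A_smul, FMod.B_smul, tr_smul_left,
    tr_smul_right, cross_smul_left, cross_smul_right]
  ring

theorem fourForm_smul₄ (k : ℚ) (x y z w : FMod c ℚ) :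
    fourForm x y z (k • w) = k * fourForm x y z w := by
  simp only [fourForm, FMod.β_smul, FMod.A_smul, FMod.B_smul, tr_smul_right, cross_smul_right]
  ring

-- The polarization of `q` is the average of `fourForm` over all 24 permutations, which makes it
-- visibly linear in each argument.
set_option maxHeartbeats 2000000 in
theorem quarticLin_eq (x y z w : FMod c ℚ) :
    quarticLin x y z w = (1 / 24) *
      (fourForm x y z w + fourForm x z y w + fourForm y x z w + fourForm y z x w
        + fourForm z x y w + fourForm z y x w
      + (fourForm x y w z + fourForm x z w y + fourForm y x w z + fourForm y z w x
        + fourForm z x w y + fourForm z y w x)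
      + (fourForm x w y z + fourForm x w z y + fourForm y w x z + fourForm y w z x
        + fourForm z w x y + fourForm z w y x)
      + (fourForm w x y z + fourForm w x z y + fourForm w y x z + fourForm w y z x
        + fourForm w z x y + fourForm w z y x)) := by
  simp only [quarticLin, ← fourForm_self, fourForm_add₁, fourForm_add₂, fourForm_add₃,
    fourForm_add₄]
  ring

theorem exists_isTriple (x y z : FMod c ℚ) : ∃ t, IsTriple x y z t := by
  let l : FMod c ℚ →ₗ[ℚ] ℚ :=
    { toFun := quarticLin x y z
      map_add' := fun v w => by
        simp only [quarticLin_eq, fourForm_add₁, fourForm_add₂, fourForm_add₃, fourForm_add₄]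
        ring
      map_smul' := fun k w => by
        simp only [quarticLin_eq, fourForm_smul₁, fourForm_smul₂, fourForm_smul₃,
          fourForm_smul₄, RingHom.id_apply, smul_eq_mul]
        ring }
  exact exists_symp_eq l

theorem isTriple_triple (x y z : FMod c ℚ) : IsTriple x y z (triple x y z) :=
  Classical.epsilon_spec (exists_isTriple x y z)

theorem IsTriple.unique {x y z t t' : FMod c ℚ} (h : IsTriple x y z t) (h' : IsTriple x y z t') :
    t = t' := by
  funext i
  rw [← symp_dualBasis t, ← symp_dualBasis t', h, h']

/-- With three equal arguments the polarization is a quarter of the derivative of `q = -2q'`. -/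
theorem quarticLin_self (x w : FMod c ℚ) : quarticLin x x x w = -halfDeriv x w := by
  have h₁ (A B : Herm c ℚ) : tr (cross A B) A = 2 * tr A.sharp B := by
    rw [tr_cross_cyclic, tr_cross_cyclic, Herm.cross_self, tr_smul_left]
  have h₂ (A B : Herm c ℚ) : tr (cross B A) A = 2 * tr A.sharp B := by
    rw [cross_comm, h₁]
  rw [quarticLin_eq]
  simp only [fourForm, halfDeriv, Herm.cross_self, tr_smul_left, tr_smul_right, h₁, cross_comm w.A
      x.A, cross_comm w.B x.B, tr_sharp_self]
  ring

theorem toRat_eq (x : FMod c ℤ) : toRat x = Int.castRingHom ℚ ∘ x := rfl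

/-- The value of `T(x, x, x)` at an integral point. -/
def intTriple (x : FMod c ℤ) : FMod c ℤ := fun i => -halfDeriv x (dualBasis ℤ i)

theorem triple_toRat (x : FMod c ℤ) :
    triple (toRat x) (toRat x) (toRat x) = toRat (intTriple x) := by
  funext i
  rw [← symp_dualBasis (triple (toRat x) (toRat x) (toRat x)) i, isTriple_triple, quarticLin_self,
    toRat_eq, ← dualBasis_map (Int.castRingHom ℚ), halfDeriv_map]
  simp [toRat, intTriple]

theorem halfDeriv_eq_sum (x w : FMod c ℤ) : halfDeriv x w = ∑ i, w i * halfGrad x i := by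
  let l : FMod c ℤ →ₗ[ℤ] ℤ :=
    { toFun := halfDeriv x
      map_add' := halfDeriv_add_right x
      map_smul' := fun k w => halfDeriv_smul_right k x w }
  classical
  have h := LinearMap.pi_apply_eq_sum_univ l w
  refine h.trans (Finset.sum_congr rfl fun i _ => ?_)
  rw [halfGrad_eq, smul_eq_mul]
  congr 1
  refine congrArg l (funext fun j => ?_)
  simp [Pi.single_apply, eq_comm]

theorem dvd_gcdVec_iff {ι : Type*} [Fintype ι] (v : ι → ℤ) (n : ℤ) :
    n ∣ gcdVec v ↔ ∀ i, n ∣ v i := by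
  simp [gcdVec, Finset.dvd_gcd_iff]

theorem gcdVec_nonneg {ι : Type*} [Fintype ι] (v : ι → ℤ) : 0 ≤ gcdVec v :=
  Int.nonneg_of_normalize_eq_self Finset.normalize_gcd

theorem gcdVec_congr {ι κ : Type*} [Fintype ι] [Fintype κ] {v : ι → ℤ} {w : κ → ℤ}
    (h : ∀ n : ℤ, (∀ i, n ∣ v i) ↔ ∀ i, n ∣ w i) : gcdVec v = gcdVec w := by
  apply Int.dvd_antisymm (gcdVec_nonneg v) (gcdVec_nonneg w)
  · rw [dvd_gcdVec_iff, ← h, ← dvd_gcdVec_iff]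
  · rw [dvd_gcdVec_iff, h, ← dvd_gcdVec_iff]

theorem dvd_halfGrad_iff (x : FMod c ℤ) (n : ℤ) :
    (∀ i, n ∣ halfGrad x i) ↔ ∀ w, n ∣ halfDeriv x w := by
  constructor
  · intro h w
    rw [halfDeriv_eq_sum]
    exact Finset.dvd_sum fun i _ => (h i).mul_left _
  · intro h i
    rw [halfGrad_eq]
    exact h _

theorem symp_intTriple (x w : FMod c ℤ) : symp (intTriple x) w = -halfDeriv x w := by
  have h := isTriple_triple (toRat x) (toRat x) (toRat x) (toRat w)
  rw [triple_toRat, quarticLin_self, toRat_eq, toRat_eq, toRat_eq, symp_map, halfDeriv_map,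
    ← map_neg] at h
  exact Int.cast_injective h

/-- Both vectors have the same common divisors as the set of all values `halfDeriv x w`. -/
theorem gcdVec_intTriple (x : FMod c ℤ) : gcdVec (intTriple x) = gcdVec (halfGrad x) := by
  refine gcdVec_congr fun n => ?_
  rw [dvd_halfGrad_iff]
  constructor
  · intro h w
    choose t ht using h
    have e : intTriple x = n • (t : FMod c ℤ) := funext ht
    rw [← dvd_neg, ← symp_intTriple, e, symp_smul_left]
    exact Dvd.intro _ rfl
  · intro h i
    exact (dvd_neg (a := n)).2 (h _)

/-- Polarization over `ℚ` writes `halfDeriv` as a combination of values of `q` at sums of `x` and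
`w`, and these values are preserved. -/
theorem halfDeriv_apply {g : FMod c ℤ ≃ₗ[ℤ] FMod c ℤ} (hg : g ∈ intGroup c) (x w : FMod c ℤ) :
    halfDeriv (g x) (g w) = halfDeriv x w := by
  have key (x w : FMod c ℤ) : (-(halfDeriv x w : ℤ) : ℚ) = (1 / 24) *
      ((quartic (x + x + x + w) - quartic (x + x + x) - 3 * quartic (x + x + w)
        + 3 * quartic (x + x) + 3 * quartic (x + w) - 3 * quartic x - quartic w : ℤ) : ℚ) := by
    have h := quarticLin_self (toRat x) (toRat w)
    have e (x y : FMod c ℤ) : toRat x + toRat y = toRat (x + y) := by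
      funext i
      simp [toRat]
    have e' (x : FMod c ℤ) : quartic (toRat x) = ((quartic x : ℤ) : ℚ) := by
      rw [toRat_eq, quartic_map]
      rfl
    have e'' : halfDeriv (toRat x) (toRat w) = ((halfDeriv x w : ℤ) : ℚ) := by
      rw [toRat_eq, toRat_eq, halfDeriv_map]
      rfl
    rw [← e'', ← h]
    simp only [quarticLin, e, e']
    push_cast
    ring
  have h := key (g x) (g w)
  simp only [← map_add, hg.1] at h
  rw [← key x w] at h
  exact_mod_cast neg_injective h

theorem gcdVec_halfGrad_apply {g : FMod c ℤ ≃ₗ[ℤ] FMod c ℤ} (hg : g ∈ intGroup c)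
    (x : FMod c ℤ) : gcdVec (halfGrad (g x)) = gcdVec (halfGrad x) := by
  refine gcdVec_congr fun n => ?_
  rw [dvd_halfGrad_iff, dvd_halfGrad_iff]
  constructor
  · intro h w
    rw [← halfDeriv_apply hg]
    exact h _
  · intro h w
    obtain ⟨v, rfl⟩ := g.surjective w
    rw [halfDeriv_apply hg]
    exact h v

end TripleProduct

/-! ### Projectivity on reduced elements and its transfer along orbits. -/

section Projective

variable {c : Coeff}

theorem halfDeriv_reduced (α β : ℤ) (a : Fin 3 → ℤ) (w : FMod c ℤ) :
    halfDeriv (FMod.mk α β (Herm.diag c a) 0) w =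
      2 * w.α * (a 0 * a 1 * a 2)
        + 2 * α * (a 1 * a 2 * w.A.d 0 + a 2 * a 0 * w.A.d 1 + a 0 * a 1 * w.A.d 2)
        - α * β * (a 0 * w.B.d 0 + a 1 * w.B.d 1 + a 2 * w.B.d 2 - w.α * β - α * w.β) := by
  have hd (i : Fin 3) : (Herm.diag c a).d i = a i := rfl
  have ho (i : Fin 3) : (Herm.diag c a).o i = 0 := rfl
  have hs : (0 : Herm c ℤ).sharp = 0 := by simpa using sharp_smul (0 : ℤ) (0 : Herm c ℤ)
  have hn : (0 : Herm c ℤ).norm = 0 := by simpa using Herm.norm_smul (0 : ℤ) (0 : Herm c ℤ)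
  simp [halfDeriv, hs, hn, tr_zero_right, tr_zero_left, cross_zero_left]
  simp [norm_eq, tr_eq, hd, ho, compNorm_zero, compMul_zero_right,
    compConj_zero, compPolar_zero_left]
  have ht : compTrace c (0 : Comp c ℤ) = 0 := by simpa using compTrace_smul c (0 : ℤ) 0
  rw [ht]
  ring

theorem dvd_gcdVec_three {p q r n : ℤ} : n ∣ gcdVec ![p, q, r] ↔ n ∣ p ∧ n ∣ q ∧ n ∣ r := by
  rw [dvd_gcdVec_iff, Fin.forall_fin_succ, Fin.forall_fin_succ, Fin.forall_fin_succ]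
  simp

theorem gcdVec_eq_one_iff {ι : Type*} [Fintype ι] {v : ι → ℤ} :
    gcdVec v = 1 ↔ ∀ n, n ∣ gcdVec v → n ∣ 1 :=
  ⟨fun h n hn => h ▸ hn,
    fun h => Int.dvd_antisymm (gcdVec_nonneg v) zero_le_one (h _ dvd_rfl) (one_dvd _)⟩

theorem formsPrimitive_reduced_iff (α β : ℤ) (a : Fin 3 → ℤ) :
    FormsPrimitive α β a 0 ↔
      ∀ i n, n ∣ α * a i → n ∣ α * β → n ∣ a (i + 1) * a (i + 2) → n ∣ 1 := by
  refine forall_congr' fun i => ?_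
  rw [gcdVec_eq_one_iff]
  refine forall_congr' fun _ => ?_
  rw [dvd_gcdVec_three]
  simp

theorem formsPrimitive_of_gcdVec_eq_one {α β : ℤ} {a : Fin 3 → ℤ}
    (h : gcdVec (halfGrad (FMod.mk α β (Herm.diag c a) 0)) = 1) : FormsPrimitive α β a 0 := by
  rw [formsPrimitive_reduced_iff]
  intro i n h1 h2 h3
  rw [← h, dvd_gcdVec_iff, dvd_halfGrad_iff]
  intro w
  rw [halfDeriv_reduced]
  refine dvd_sub (dvd_add ?_ ?_) (h2.mul_right _)
  · refine Dvd.dvd.mul_left ?_ _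
    fin_cases i
    · exact (h3.mul_left (a 0)).trans (dvd_of_eq (by simp; ring))
    · exact (h3.mul_left (a 1)).trans (dvd_of_eq (by simp; ring))
    · exact (h3.mul_left (a 2)).trans (dvd_of_eq (by simp; ring))
  · rw [mul_assoc]
    refine Dvd.dvd.mul_left ?_ _
    obtain ⟨k, hk⟩ := h1
    obtain ⟨l, hl⟩ := h3
    fin_cases i
    · simp at hk hl
      exact ⟨α * l * w.A.d 0 + k * a 2 * w.A.d 1 + k * a 1 * w.A.d 2, by
        linear_combination (a 2 * w.A.d 1 + a 1 * w.A.d 2) * hk + α * w.A.d 0 * hl⟩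
    · simp at hk hl
      exact ⟨k * a 2 * w.A.d 0 + α * l * w.A.d 1 + k * a 0 * w.A.d 2, by
        linear_combination (a 2 * w.A.d 0 + a 0 * w.A.d 2) * hk + α * w.A.d 1 * hl⟩
    · simp at hk hl
      exact ⟨k * a 1 * w.A.d 0 + k * a 0 * w.A.d 1 + α * l * w.A.d 2, by
        linear_combination (a 1 * w.A.d 0 + a 0 * w.A.d 1) * hk + α * w.A.d 2 * hl⟩

theorem not_formsPrimitive_of_gcdVec {α β : ℤ} {a : Fin 3 → ℤ} (hα : 0 < α) (hβ : α ∣ β)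
    (ha : ∀ i, α ∣ a i) (h : 3 ≤ gcdVec (halfGrad (FMod.mk α β (Herm.diag c a) 0)) ∨
      gcdVec (halfGrad (FMod.mk α β (Herm.diag c a) 0)) = 0) : ¬ FormsPrimitive α β a 0 := by
  rw [formsPrimitive_reduced_iff]
  intro hf
  -- Since `α` divides `β` and every `a i`, it divides all coefficients of the form with index 0.
  obtain rfl : α = 1 := Int.eq_one_of_dvd_one hα.le
    (hf 0 α (Dvd.intro _ rfl) (Dvd.intro _ rfl) ((ha _).mul_right _))
  have hG := (dvd_halfGrad_iff _ _).1 ((dvd_gcdVec_iff _ _).1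
    (dvd_refl (gcdVec (halfGrad (FMod.mk 1 β (Herm.diag c a) 0)))))
  generalize gcdVec (halfGrad (FMod.mk 1 β (Herm.diag c a) 0)) = G at h hG
  simp only [halfDeriv_reduced] at hG
  have e0 := hG (FMod.mk 0 1 0 0)
  have e1 := hG (FMod.mk 0 0 (Herm.diag c ![1, 0, 0]) 0)
  have e2 := hG (FMod.mk 0 0 (Herm.diag c ![0, 1, 0]) 0)
  have e3 := hG (FMod.mk 0 0 (Herm.diag c ![0, 0, 1]) 0)
  have hd (b : Fin 3 → ℤ) (i : Fin 3) : (Herm.diag c b).d i = b i := rfl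
  simp [hd] at e0 e1 e2 e3
  -- Take `p = 2` if 4 divides `G`, otherwise an odd prime divisor of `G`; in both cases the factor
  -- 2 in the gradient entries can be cancelled.
  have key : ∃ p : ℤ, Prime p ∧ p ∣ β ∧ ∀ m, G ∣ 2 * m → p ∣ m := by
    have h4 : (4 : ℤ) ∣ G ∨ ∃ p : ℕ, p.Prime ∧ (p : ℤ) ∣ G ∧ Odd p := by
      rcases h with h | h
      · obtain ⟨g, rfl⟩ := Int.eq_ofNat_of_zero_le (by omega : 0 ≤ G)
        rcases Nat.four_dvd_or_exists_odd_prime_and_dvd_of_two_lt (n := g) (by omega) with h | h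
        · exact Or.inl (by exact_mod_cast h)
        · obtain ⟨p, h1, h2, h3⟩ := h
          exact Or.inr ⟨p, h1, by exact_mod_cast h2, h3⟩
      · exact Or.inl (h ▸ dvd_zero _)
    rcases h4 with h4 | ⟨p, hp, hpG, hodd⟩
    · refine ⟨2, Int.prime_two, ?_, fun m hm => ?_⟩
      · exact (Dvd.intro 2 (by norm_num)).trans (h4.trans e0)
      · have := h4.trans hm
        omega
    · have hp' := Nat.prime_iff_prime_int.1 hp
      refine ⟨p, hp', hpG.trans e0, fun m hm => ?_⟩
      rcases hp'.dvd_or_dvd (hpG.trans hm) with h | h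
      · exfalso
        have h' : p ∣ 2 := by exact_mod_cast h
        rw [Nat.prime_dvd_prime_iff_eq hp Nat.prime_two] at h'
        rw [h'] at hodd
        exact absurd hodd (by decide)
      · exact h
  obtain ⟨p, hp, hpβ, hpG⟩ := key
  -- From `p ∣ a 0 * a 1`, either `p ∣ a 0` and the form 0 fails to be primitive, or `p ∣ a 1` and
  -- the form 1 does.
  rcases hp.dvd_or_dvd (hpG _ e3) with h0 | h0
  · exact hp.not_isUnit (isUnit_of_dvd_one (hf 0 p (by simpa using h0) (by simpa using hpβ)
      (hpG _ e1)))
  · exact hp.not_isUnit (isUnit_of_dvd_one (hf 1 p (by simpa using h0) (by simpa using hpβ)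
      (hpG _ e2)))

/-- The substitution that replaces `X, Y` by `X, Y - kX` in `pX² + qXY + rY²` is unimodular, so it
keeps the content. -/
theorem gcdVec_shear (p q r k : ℤ) :
    gcdVec ![p - k * q + k ^ 2 * r, q - 2 * k * r, r] = gcdVec ![p, q, r] := by
  have key (n : ℤ) : (n ∣ p - k * q + k ^ 2 * r ∧ n ∣ q - 2 * k * r ∧ n ∣ r) ↔
      (n ∣ p ∧ n ∣ q ∧ n ∣ r) := by
    constructor
    · rintro ⟨h1, h2, h3⟩
      have h4 : n ∣ q := (dvd_sub_left (h3.mul_left _)).1 h2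
      exact ⟨(dvd_sub_left (h4.mul_left _)).1 ((dvd_add_left (h3.mul_left _)).1 h1), h4, h3⟩
    · rintro ⟨h1, h2, h3⟩
      exact ⟨(h1.sub (h2.mul_left _)).add (h3.mul_left _), h2.sub (h3.mul_left _), h3⟩
  refine gcdVec_congr fun n => ?_
  rw [← dvd_gcdVec_iff, ← dvd_gcdVec_iff, dvd_gcdVec_three, dvd_gcdVec_three, key]

theorem gcdVec_reverse (p q r : ℤ) : gcdVec ![r, -q, p] = gcdVec ![p, q, r] := by
  refine gcdVec_congr fun n => ?_
  rw [← dvd_gcdVec_iff, ← dvd_gcdVec_iff, dvd_gcdVec_three, dvd_gcdVec_three, dvd_neg]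
  tauto

theorem isProjective_swap (x : FMod .zero ℤ) : IsProjective (swap .zero x) ↔ IsProjective x := by
  refine forall_congr' fun i => ?_
  rw [← gcdVec_reverse]
  simp only [swap_apply, FMod.α_mk, FMod.β_mk, FMod.A_mk, FMod.B_mk, d_neg]
  refine Eq.congr_left (congrArg gcdVec ?_)
  funext j
  fin_cases j <;> simp <;> ring

theorem isProjective_trans (x : FMod .zero ℤ) (p : HermIdx .zero) (k : ℤ) :
    IsProjective (trans (Pi.single p k) (sharp_single p k) x) ↔ IsProjective x := by
  rcases p with i | ⟨-, t⟩
  · refine forall_congr' fun j => ?_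
    -- A translation along the `i`-th unit shears the form with index `i` and fixes the other two;
    -- the parameter `-k` undoes the shear.
    rw [← gcdVec_shear _ _ _ (if j = i then -k else 0)]
    refine Eq.congr_left (congrArg gcdVec ?_)
    have hp (u v : Comp .zero ℤ) : compPolar .zero u v = 0 := rfl
    fin_cases i <;> fin_cases j <;> funext l <;> fin_cases l <;>
      simp [d_single_inl, hp, tr_eq, -zsmul_eq_mul] <;> ring
  · exact t.elim0

theorem isProjective_apply {g : FMod .zero ℤ ≃ₗ[ℤ] FMod .zero ℤ} (hg : g ∈ elemGroup .zero)
    (x : FMod .zero ℤ) : IsProjective (g x) ↔ IsProjective x := by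
  induction hg using Subgroup.closure_induction generalizing x with
  | mem g hg =>
    rcases hg with rfl | ⟨p, k, rfl⟩
    · exact isProjective_swap x
    · exact isProjective_trans x p k
  | one => exact Iff.rfl
  | mul g h _ _ ihg ihh => rw [LinearEquiv.mul_apply, ihg, ihh]
  | inv g _ ih =>
    rw [← ih (g⁻¹ x)]
    exact iff_of_eq (congrArg IsProjective (g.apply_symm_apply x))

theorem halfDeriv_zero_left (w : FMod c ℤ) : halfDeriv 0 w = 0 := by
  have h := halfDeriv_reduced (c := c) 0 0 0 w
  have e : FMod.mk 0 0 (Herm.diag c 0) 0 = (0 : FMod c ℤ) := by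
    apply FMod.ext'
    any_goals rfl
    exact ext' (fun _ => rfl) fun _ => rfl
  rw [e] at h
  simpa using h

theorem gcdVec_halfGrad_zero : gcdVec (halfGrad (0 : FMod c ℤ)) = 0 := by
  rw [← zero_dvd_iff, dvd_gcdVec_iff, dvd_halfGrad_iff]
  intro w
  rw [halfDeriv_zero_left]

theorem isProjective_of_gcdVec_eq_one (x : FMod c ℤ) (h : gcdVec (halfGrad x) = 1) :
    IsProjective x := by
  have hx : x ≠ 0 := by
    rintro rfl
    rw [gcdVec_halfGrad_zero] at h
    exact zero_ne_one h
  obtain ⟨α, β, a, hα, hβ, ha, g, hg, hgx⟩ := exists_diagonal_reduced hx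
  have hf : FormsPrimitive α β a 0 := by
    rw [← gcdVec_halfGrad_apply (elemGroup_le c hg), hgx] at h
    exact formsPrimitive_of_gcdVec_eq_one h
  have ho : OrbitProjective x := ⟨g, elemGroup_le c hg, α, β, a, hα, hβ, ha, hgx, hf⟩
  cases c
  · rw [← isProjective_apply hg, hgx]
    exact hf
  · exact ho
  · exact ho
  · exact ho

theorem not_isProjective (x : FMod c ℤ) (h : 3 ≤ gcdVec (halfGrad x) ∨ grad x = 0) :
    ¬ IsProjective x := by
  have h' : 3 ≤ gcdVec (halfGrad x) ∨ gcdVec (halfGrad x) = 0 := by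
    refine h.imp_right fun h => ?_
    rw [← zero_dvd_iff, dvd_gcdVec_iff]
    intro i
    simp [halfGrad, h]
  have ho : ¬ OrbitProjective x := by
    rintro ⟨g, hg, α, β, a, hα, hβ, ha, hgx, hf⟩
    rw [← gcdVec_halfGrad_apply hg, hgx] at h'
    exact not_formsPrimitive_of_gcdVec hα hβ ha h' hf
  cases c
  -- The diagonal algebra has no orbit in its definition: at zero all forms vanish, and otherwise
  -- projectivity is carried to a reduced element.
  · by_cases hx : x = 0
    · rintro hp
      have h0 : gcdVec _ = (1 : ℤ) := hp 0
      have h1 : (0 : ℤ) ∣ 1 := by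
        rw [← h0, dvd_gcdVec_three]
        simp [hx, FMod.α, FMod.β, FMod.A, FMod.B, Herm.d]
      omega
    · obtain ⟨α, β, a, hα, hβ, ha, g, hg, hgx⟩ := exists_diagonal_reduced hx
      rw [← isProjective_apply hg, hgx]
      rw [← gcdVec_halfGrad_apply (elemGroup_le _ hg), hgx] at h'
      exact not_formsPrimitive_of_gcdVec hα hβ ha h'
  · exact ho
  · exact ho
  · exact ho

end Projective
end Freudenthal

open Freudenthal
theorem corollary4 (c : Coeff) :
    (∀ x y z : FMod c ℚ,
      IsTriple x y z (triple x y z) ∧ ∀ t, IsTriple x y z t → t = triple x y z) ∧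
    (∀ i, ∃ D : MvPolynomial (FIdx c) ℤ, MvPolynomial.pderiv i (quarticPoly c) = 2 * D) ∧
    ∀ x : FMod c ℤ,
      (∃ t : FMod c ℤ, triple (toRat x) (toRat x) (toRat x) = toRat t ∧
        gcdVec t = gcdVec (halfGrad x)) ∧
      (gcdVec (halfGrad x) = 1 → IsProjective x) ∧
      (3 ≤ gcdVec (halfGrad x) ∨ grad x = 0 → ¬ IsProjective x) :=
  ⟨fun x y z => ⟨isTriple_triple x y z, fun _ ht => ht.unique (isTriple_triple x y z)⟩,
    fun i => ⟨_, pderiv_quarticPoly i⟩,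
    fun x => ⟨⟨intTriple x, triple_toRat x, gcdVec_intTriple x⟩,
      isProjective_of_gcdVec_eq_one x, not_isProjective x⟩⟩
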